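/- A pregraph is a multigraph in which loops and semi-edges (edges with only one end, contributing 1 to the degree of their vertex) are also allowed; a loop contributes 2 to the degree. All pregraphs here are finite and connected. A quotient of $C_4$ is a pregraph isomorphic to one of: the 4-cycle; two vertices joined by two parallel edges; two vertices joined by one edge and each incident to one semi-edge; one vertex with two semi-edges. A $C_4^q$-factor of a cubic (i.e. 3-regular) pregraph is a 2-factor (a spanning 2-regular sub-pregraph) each of whose components is a quotient of $C_4$. A connected cubic pregraph is $C_4^q$-markable if it has a $C_4^q$-factor. Two $C_4^q$-factors of a pregraph $P$ are isomorphic if some automorphism of $P$ maps one onto the other. Pregraphs are counted up to isomorphism. The barbed path on $n\ge 2$ vertices is the path on $n$ vertices whose end points are additionally incident to two semi-edges each, and all of whose other vertices are additionally incident to one semi-edge each. For even $n$, let $L$ be the cartesian product of $K_2$ and the path with $n/2$ vertices. At each of the two ends of the path there are two corresponding vertices of $L$; "closing" that end means joining these two vertices by an extra edge, and "opening" it means attaching one semi-edge to each of them. The double-closed, double-open and open-closed ladder on $n$ vertices is obtained from $L$ by closing both ends, opening both ends, or opening one end and closing the other, respectively. (For $n=2$ the two ends of the path coincide and both operations are applied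 to the same two vertices; so the open-closed ladder on 2 vertices consists of two vertices joined by two parallel edges, each incident to one semi-edge.) **Theorem.** For each integer $n>0$, the number of $C_4^q$-markable pregraphs on $n$ vertices that have at least two non-isomorphic $C_4^q$-factors depends only on $n \bmod 4$: - if $n$ is odd, it is $0$; - if $n\equiv 0 \pmod 4$, it is $4$, and these pregraphs are the barbed path, the double-closed ladder, the double-open ladder and the open-closed ladder on $n$ vertices; - if $n\equiv 2 \pmod 4$, it is $2$, and these pregraphs are the barbed path and the open-closed ladder on $n$ vertices. Moreover, every $C_4^q$-markable pregraph has at most two non-isomorphic $C_4^q$-factors; that is, among any three of its $C_4^q$-factors two are isomorphic. -/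

import Mathlib

/-- A pregraph: a multigraph that may also have loops and semi-edges, given by its darts
(half-edges). Every dart `d` starts at the vertex `origin d`, and the involution `rev` exchanges the
two darts of an edge. The edges are the orbits of `rev`: a fixed point of `rev` is a semi-edge; an
orbit of two darts is an ordinary edge if the darts start at different vertices and a loop if they
start at the same vertex. Several edges may join the same vertices. -/
structure Pregraph where
  Vert : Type
  Dart : Type
  origin : Dart → Vert
  rev : Dart → Dart
  rev_rev : ∀ d, rev (rev d) = d

namespace Pregraph

/-- An isomorphism of pregraphs: compatible bijections between vertices and between darts. -/
structure Iso (P Q : Pregraph) where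
  vert : P.Vert ≃ Q.Vert
  dart : P.Dart ≃ Q.Dart
  origin_dart : ∀ d, Q.origin (dart d) = vert (P.origin d)
  rev_dart : ∀ d, Q.rev (dart d) = dart (P.rev d)

/-- `P` and `Q` are isomorphic. -/
def Isomorphic (P Q : Pregraph) : Prop := Nonempty (Iso P Q)

theorem Isomorphic.refl (P : Pregraph) : P.Isomorphic P :=
  ⟨⟨Equiv.refl _, Equiv.refl _, fun _ => rfl, fun _ => rfl⟩⟩

theorem Isomorphic.symm {P Q : Pregraph} (h : P.Isomorphic Q) : Q.Isomorphic P := by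
  obtain ⟨f⟩ := h
  refine ⟨⟨f.vert.symm, f.dart.symm, fun d => ?_, fun d => ?_⟩⟩
  · rw [Equiv.eq_symm_apply, ← f.origin_dart, Equiv.apply_symm_apply]
  · rw [Equiv.eq_symm_apply, ← f.rev_dart, Equiv.apply_symm_apply]

theorem Isomorphic.trans {P Q R : Pregraph} (h : P.Isomorphic Q) (h' : Q.Isomorphic R) :
    P.Isomorphic R := by
  obtain ⟨f⟩ := h
  obtain ⟨g⟩ := h'
  exact ⟨⟨f.vert.trans g.vert, f.dart.trans g.dart,
    fun d => by simp [f.origin_dart, g.origin_dart],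
    fun d => by simp [f.rev_dart, g.rev_dart]⟩⟩

/-- Isomorphism as an equivalence relation on pregraphs. -/
instance isoSetoid : Setoid Pregraph where
  r := Isomorphic
  iseqv := ⟨Isomorphic.refl, Isomorphic.symm, Isomorphic.trans⟩

/-- `v` and `w` are joined by an edge (or `v = w` and there is a loop or a semi-edge at `v`). -/
def Adj (P : Pregraph) (v w : P.Vert) : Prop :=
  ∃ d, P.origin d = v ∧ P.origin (P.rev d) = w

/-- There is a walk from `v` to `w`. -/
def Reachable (P : Pregraph) : P.Vert → P.Vert → Prop := Relation.ReflTransGen P.Adj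

/-- `P` is connected. -/
def IsConnected (P : Pregraph) : Prop := Nonempty P.Vert ∧ ∀ v w, P.Reachable v w

/-- `P` is cubic: every vertex has degree 3 (a loop counts twice, a semi-edge once). -/
def IsCubic (P : Pregraph) : Prop := ∀ v, {d | P.origin d = v}.encard = 3

theorem reachable_origin_rev (P : Pregraph) {v : P.Vert} {d : P.Dart}
    (h : P.Reachable v (P.origin d)) : P.Reachable v (P.origin (P.rev d)) :=
  Relation.ReflTransGen.tail h ⟨d, rfl, rfl⟩

/-- The connected component of `P` that contains the vertex `v`. -/
abbrev component (P : Pregraph) (v : P.Vert) : Pregraph where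
  Vert := {w // P.Reachable v w}
  Dart := {d // P.Reachable v (P.origin d)}
  origin d := ⟨P.origin d.1, d.2⟩
  rev d := ⟨P.rev d.1, P.reachable_origin_rev d.2⟩
  rev_rev d := Subtype.ext (P.rev_rev d.1)

/-- The quotient `q₁` of `C₄`: the 4-cycle itself. The dart `(i, true)` leads from `i` to `i + 1`,
the dart `(i, false)` from `i` to `i - 1`. -/
abbrev q1 : Pregraph where
  Vert := ZMod 4
  Dart := ZMod 4 × Bool
  origin d := d.1
  rev d := if d.2 then (d.1 + 1, false) else (d.1 - 1, true)
  rev_rev := by rintro ⟨i, _ | _⟩ <;> simp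

/-- The quotient `q₂` of `C₄`: two vertices joined by two parallel edges. -/
abbrev q2 : Pregraph where
  Vert := Bool
  Dart := Bool × Bool
  origin d := d.1
  rev d := (!d.1, d.2)
  rev_rev := by simp

/-- The quotient `q₃` of `C₄`: two vertices joined by one edge (the darts `(v, true)`), each
incident to one semi-edge (the dart `(v, false)`). -/
abbrev q3 : Pregraph where
  Vert := Bool
  Dart := Bool × Bool
  origin d := d.1
  rev d := if d.2 then (!d.1, true) else d
  rev_rev := by rintro ⟨v, _ | _⟩ <;> simp

/-- The quotient `q₄` of `C₄`: one vertex with two semi-edges. -/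
abbrev q4 : Pregraph where
  Vert := Unit
  Dart := Bool
  origin _ := ()
  rev d := d
  rev_rev _ := rfl

/-- `P` is a quotient of `C₄`. -/
def IsC4Quotient (P : Pregraph) : Prop :=
  P.Isomorphic q1 ∨ P.Isomorphic q2 ∨ P.Isomorphic q3 ∨ P.Isomorphic q4

/-- A 2-factor of `P`: a set of edges (given by its darts) such that in the spanning sub-pregraph
with these edges every vertex has degree 2. -/
structure TwoFactor (P : Pregraph) where
  darts : Set P.Dart
  rev_mem : ∀ d ∈ darts, P.rev d ∈ darts
  degree_eq : ∀ v, {d | d ∈ darts ∧ P.origin d = v}.encard = 2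

/-- The spanning sub-pregraph formed by a 2-factor. -/
abbrev TwoFactor.toPregraph {P : Pregraph} (F : P.TwoFactor) : Pregraph where
  Vert := P.Vert
  Dart := F.darts
  origin d := P.origin d.1
  rev d := ⟨P.rev d.1, F.rev_mem d.1 d.2⟩
  rev_rev d := Subtype.ext (P.rev_rev d.1)

/-- `F` is a `C₄`-quotient factor: each of its components is a quotient of `C₄`. -/
def TwoFactor.IsC4QuotientFactor {P : Pregraph} (F : P.TwoFactor) : Prop :=
  ∀ v : P.Vert, (F.toPregraph.component v).IsC4Quotient

/-- Two 2-factors of `P` are isomorphic if an automorphism of `P` maps one onto the other. -/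
def TwoFactor.Isomorphic {P : Pregraph} (F G : P.TwoFactor) : Prop :=
  ∃ f : Iso P P, f.dart '' F.darts = G.darts

/-- `P` is a connected cubic pregraph that has a `C₄`-quotient factor. -/
def IsC4QuotientMarkable (P : Pregraph) : Prop :=
  P.IsConnected ∧ P.IsCubic ∧ ∃ F : P.TwoFactor, F.IsC4QuotientFactor

/-- `P` has (at least) two non-isomorphic `C₄`-quotient factors. -/
def HasMultipleC4QuotientFactors (P : Pregraph) : Prop :=
  ∃ F G : P.TwoFactor, F.IsC4QuotientFactor ∧ G.IsC4QuotientFactor ∧ ¬ F.Isomorphic G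

/-- The isomorphism classes of the connected cubic pregraphs on `n` vertices that have several
pairwise non-isomorphic `C₄`-quotient factors. -/
def multipleFactorClasses (n : ℕ) : Set (Quotient isoSetoid) :=
  {c | ∃ P : Pregraph, Nat.card P.Vert = n ∧ P.IsC4QuotientMarkable ∧
    P.HasMultipleC4QuotientFactors ∧ ⟦P⟧ = c}

/-- The barbed path on `n` vertices `0, …, n - 1`. Every vertex `i` has three darts: `(i, 0)` is a
semi-edge, `(i, 1)` belongs to the edge to `i - 1` and `(i, 2)` to the edge to `i + 1`; at the two
end points, where that neighbour is missing, the latter dart is a second semi-edge. -/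
abbrev barbedPath (n : ℕ) : Pregraph where
  Vert := Fin n
  Dart := Fin n × Fin 3
  origin d := d.1
  rev
    | (i, 0) => (i, 0)
    | (i, 1) => if 0 < i.1 then (⟨i.1 - 1, by omega⟩, 2) else (i, 1)
    | (i, 2) => if h : i.1 + 1 < n then (⟨i.1 + 1, h⟩, 1) else (i, 2)
  rev_rev := by
    rintro ⟨⟨i, hi⟩, s⟩
    fin_cases s
    · rfl
    · rcases Nat.eq_zero_or_pos i with rfl | h
      · simp
      · have h1 : i - 1 + 1 = i := by omega
        simp [h, h1, hi]
    · by_cases h : i + 1 < n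
      · simp [h]
      · simp [h]

/-- The cartesian product of `K₂` and the path with `m` vertices, completed at its two ends. The
vertex `(i, s)` has three darts: `((i, s), 0)` belongs to the rung to `(i, !s)`, `((i, s), 1)` to
the edge to `(i - 1, s)`, and `((i, s), 2)` to the edge to `(i + 1, s)`. At the end `i = 0`, where
`i - 1` is missing, the two darts `((0, s), 1)` form an extra edge between `(0, false)` and
`(0, true)` if `closedStart` is true, and are semi-edges otherwise; likewise at the end `i = m - 1`
for the darts `((m - 1, s), 2)` and `closedEnd`. -/
abbrev ladder (closedStart closedEnd : Bool) (m : ℕ) : Pregraph where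
  Vert := Fin m × Bool
  Dart := (Fin m × Bool) × Fin 3
  origin d := d.1
  rev
    | ((i, s), 0) => ((i, !s), 0)
    | ((i, s), 1) =>
      if 0 < i.1 then ((⟨i.1 - 1, by omega⟩, s), 2)
      else if closedStart then ((i, !s), 1) else ((i, s), 1)
    | ((i, s), 2) =>
      if h : i.1 + 1 < m then ((⟨i.1 + 1, h⟩, s), 1)
      else if closedEnd then ((i, !s), 2) else ((i, s), 2)
  rev_rev := by
    rintro ⟨⟨⟨i, hi⟩, t⟩, s⟩
    fin_cases s
    · simp
    · rcases Nat.eq_zero_or_pos i with rfl | h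
      · cases closedStart <;> simp
      · have h1 : i - 1 + 1 = i := by omega
        simp [h, h1, hi]
    · by_cases h : i + 1 < m
      · simp [h]
      · cases closedEnd <;> simp [h]

/-- The double-closed ladder with `m` rungs (on `2 * m` vertices). -/
abbrev doubleClosedLadder (m : ℕ) : Pregraph := ladder true true m

/-- The double-open ladder with `m` rungs (on `2 * m` vertices). -/
abbrev doubleOpenLadder (m : ℕ) : Pregraph := ladder false false m

/-- The open-closed ladder with `m` rungs (on `2 * m` vertices). For `m = 1` it consists of two
vertices joined by two parallel edges and each incident to one semi-edge. -/
abbrev openClosedLadder (m : ℕ) : Pregraph := ladder false true m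

end Pregraph

/-! In a cubic pregraph a 2-factor omits exactly one dart at each vertex, so its complement is an
involution of the vertices, `TwoFactor.partner`. Components that are quotients of C₄ are recognized
by the local condition `IsSquareAt`, and a vertex bijection that respects the numbers of edges
inside and outside the factors lifts to the darts (`exists_iso`). Hence the argument can be carried
out on vertices.

Let φ and ψ be the partner maps of two such factors F and G. If φ = ψ, the factors are isomorphic.
If they differ at one vertex, the squares force them to differ everywhere, and the edges common to F
and G define a third involution χ that commutes with both (`TwoFactor.exists_isCommutingTriple`).
Walk along φ and ψ alternately, p : ℤ → V. By commutation the vertices p i and χ (p i) exhaust the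
pregraph. A coincidence of p i with p j or χ (p j) propagates along the walk: to a translation if i
- j is even, to a reflection if it is odd (`walk_translate`, `walk_reflect`).

Without reflections, moving one step along the walk exchanges φ and ψ, hence F and G. With a
reflection, finiteness yields a second one, and the pregraph is carried by a segment of m walk
vertices. At each end of it the outgoing step returns to the same vertex or to its χ-image. If χ is
the identity this is a barbed path; otherwise χ has no fixed points and this is a ladder whose ends
are open or closed accordingly. If m is odd and the ends are alike, reversing the segment exchanges
φ and ψ. The remaining pregraphs are the exceptions, and there the factors that pair consecutive
vertices or rungs from parity 0 or 1 are told apart at the ends.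

Among three pairwise non-isomorphic factors, the χ of each pair would be the partner map of the
third. The three maps then commute pairwise, each is the identity or has no fixed points, and some
two of them can always be exchanged. -/

namespace Pregraph

/-! ### Neighbour multisets -/

/-- The end of a dart other than its origin. -/
def target (P : Pregraph) (d : P.Dart) : P.Vert := P.origin (P.rev d)

/-- The darts in `S` that start at `v`. -/
def dartsAt (P : Pregraph) (S : Set P.Dart) (v : P.Vert) : Set P.Dart := {d | d ∈ S ∧ P.origin d = v}

/-- Every vertex has finite degree. -/
def LocallyFinite (P : Pregraph) : Prop := ∀ v, {d | P.origin d = v}.Finite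

/-- `P` has no loops. -/
def Loopless (P : Pregraph) : Prop := ∀ d, P.target d = P.origin d → P.rev d = d

open Classical in
/-- The multiset of the neighbours of `v` along the darts in `S`. -/
noncomputable def nbrs (P : Pregraph) (S : Set P.Dart) (v : P.Vert) : Multiset P.Vert :=
  -- The default 0 at infinite degree occurs on both sides in `nbrs_map`, which therefore needs no
  -- finiteness.
  if h : (P.dartsAt S v).Finite then h.toFinset.val.map P.target else 0

variable {P Q : Pregraph}

theorem target_rev (d : P.Dart) : P.target (P.rev d) = P.origin d := by
  rw [target, P.rev_rev]

theorem LocallyFinite.dartsAt (h : P.LocallyFinite) (S : Set P.Dart) (v : P.Vert) :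
    (P.dartsAt S v).Finite :=
  (h v).subset fun _ hd => hd.2

theorem IsCubic.locallyFinite (h : P.IsCubic) : P.LocallyFinite := fun v =>
  Set.finite_of_encard_eq_coe (k := 3) (h v)

theorem nbrs_of_dartsAt_eq {S : Set P.Dart} {v : P.Vert} {s : Finset P.Dart}
    (h : P.dartsAt S v = s) : P.nbrs S v = s.val.map P.target := by
  have hf : (P.dartsAt S v).Finite := h ▸ s.finite_toSet
  rw [nbrs, dif_pos hf]
  congr 2
  ext d
  simp [h]

theorem nbrs_singleton {S : Set P.Dart} {v : P.Vert} {d : P.Dart} (h : P.dartsAt S v = {d}) :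
    P.nbrs S v = {P.target d} := by
  classical
  rw [nbrs_of_dartsAt_eq (s := {d}) (by simpa using h)]
  simp

theorem nbrs_pair {S : Set P.Dart} {v : P.Vert} {d e : P.Dart} (h : P.dartsAt S v = {d, e})
    (hde : d ≠ e) : P.nbrs S v = {P.target d, P.target e} := by
  classical
  rw [nbrs_of_dartsAt_eq (s := {d, e}) (by simpa using h), Finset.insert_val_of_notMem (by simpa)]
  simp

theorem nbrs_triple {S : Set P.Dart} {v : P.Vert} {d e f : P.Dart}
    (h : P.dartsAt S v = {d, e, f}) (hde : d ≠ e) (hdf : d ≠ f) (hef : e ≠ f) :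
    P.nbrs S v = {P.target d, P.target e, P.target f} := by
  classical
  rw [nbrs_of_dartsAt_eq (s := {d, e, f}) (by simpa using h),
    Finset.insert_val_of_notMem (by simp [hde, hdf]), Finset.insert_val_of_notMem (by simpa)]
  simp

theorem nbrs_add_compl (hP : P.LocallyFinite) (S : Set P.Dart) (v : P.Vert) :
    P.nbrs Sᶜ v + P.nbrs S v = P.nbrs Set.univ v := by
  classical
  have h : P.dartsAt Set.univ v = ((hP.dartsAt Sᶜ v).toFinset.disjUnion (hP.dartsAt S v).toFinset
      (by
        rw [Finset.disjoint_left]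
        intro d h1 h2
        simp only [Set.Finite.mem_toFinset] at h1 h2
        exact h1.1 h2.1) : Finset P.Dart) := by
    ext d
    simp only [dartsAt, Finset.coe_disjUnion, Set.Finite.coe_toFinset, Set.mem_union,
      Set.mem_ofPred_eq, Set.mem_univ, Set.mem_compl_iff]
    tauto
  rw [nbrs_of_dartsAt_eq h, nbrs, nbrs, dif_pos (hP.dartsAt _ _), dif_pos (hP.dartsAt _ _)]
  simp [Finset.disjUnion]

theorem nbrs_empty (v : P.Vert) : P.nbrs ∅ v = 0 := by
  rw [nbrs_of_dartsAt_eq (s := ∅) (by simp [dartsAt])]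
  simp

open Classical in
theorem count_nbrs (hP : P.LocallyFinite) (S : Set P.Dart) (v w : P.Vert) :
    (P.nbrs S v).count w = {d | d ∈ S ∧ P.origin d = v ∧ P.target d = w}.ncard := by
  rw [nbrs, dif_pos (hP.dartsAt _ _), Multiset.count_map, ← Finset.filter_val, Finset.card_val,
    ← Set.ncard_coe_finset]
  congr 1
  ext d
  simp [dartsAt, and_assoc, eq_comm]

open Classical in
theorem count_nbrs_comm (hP : P.LocallyFinite) {S : Set P.Dart} (hS : ∀ d, d ∈ S → P.rev d ∈ S)
    (v w : P.Vert) : (P.nbrs S v).count w = (P.nbrs S w).count v := by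
  rw [count_nbrs hP, count_nbrs hP]
  refine Set.ncard_congr (fun d _ => P.rev d) ?_ ?_ ?_
  · rintro d ⟨h1, h2, h3⟩
    exact ⟨hS d h1, h3, by rw [target_rev, h2]⟩
  · intro d e _ _ h
    rw [← P.rev_rev d, h, P.rev_rev]
  · rintro d ⟨h1, h2, h3⟩
    exact ⟨P.rev d, ⟨hS d h1, h3, by rw [target_rev, h2]⟩, P.rev_rev d⟩

/-- Neighbours correspond under a map that is bijective on the darts at a vertex. -/
theorem nbrs_map {S : Set Q.Dart} {T : Set P.Dart} {v : Q.Vert} (g : Q.Vert → P.Vert)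
    (f : Q.Dart → P.Dart) (hf : Set.BijOn f (Q.dartsAt S v) (P.dartsAt T (g v)))
    (ht : ∀ d, P.target (f d) = g (Q.target d)) : P.nbrs T (g v) = (Q.nbrs S v).map g := by
  classical
  by_cases h : (Q.dartsAt S v).Finite
  · have h' : P.dartsAt T (g v) = (h.toFinset.image f : Finset P.Dart) := by
      rw [← hf.image_eq]
      simp
    rw [nbrs_of_dartsAt_eq h', nbrs, dif_pos h, Finset.image_val_of_injOn (by simpa using hf.injOn),
      Multiset.map_map, Multiset.map_map]
    exact Multiset.map_congr rfl fun d _ => ht d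
  · have h' : ¬ (P.dartsAt T (g v)).Finite := by rwa [← hf.finite_iff_finite]
    rw [nbrs, nbrs, dif_neg h, dif_neg h', Multiset.map_zero]

theorem Iso.target_dart (f : Iso P Q) (d : P.Dart) : Q.target (f.dart d) = f.vert (P.target d) := by
  rw [target, target, f.rev_dart, f.origin_dart]

theorem Iso.nbrs_image (f : Iso P Q) (S : Set P.Dart) (v : P.Vert) :
    Q.nbrs (f.dart '' S) (f.vert v) = (P.nbrs S v).map f.vert := by
  refine nbrs_map f.vert f.dart ⟨?_, f.dart.injective.injOn, ?_⟩ f.target_dart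
  · rintro d ⟨h1, h2⟩
    exact ⟨⟨d, h1, rfl⟩, by rw [f.origin_dart, h2]⟩
  · rintro _ ⟨⟨d, h1, rfl⟩, h2⟩
    rw [f.origin_dart] at h2
    exact ⟨d, ⟨h1, f.vert.injective h2⟩, rfl⟩

/-! ### Lifting vertex bijections to isomorphisms -/

/-- A bijection between the vertices of loopless pregraphs that respects the numbers of edges in `S`
and of edges outside `S` is induced by an isomorphism. -/
theorem exists_iso (hP : P.LocallyFinite) (hQ : Q.LocallyFinite) (lP : P.Loopless)
    (lQ : Q.Loopless) {S : Set P.Dart} {T : Set Q.Dart} (hS : ∀ d, d ∈ S → P.rev d ∈ S)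
    (hT : ∀ d, d ∈ T → Q.rev d ∈ T) (α : P.Vert ≃ Q.Vert)
    (h1 : ∀ v, Q.nbrs T (α v) = (P.nbrs S v).map α)
    (h2 : ∀ v, Q.nbrs Tᶜ (α v) = (P.nbrs Sᶜ v).map α) :
    ∃ f : Iso P Q, f.dart '' S = T := by
  classical
  -- An arbitrary linear order on the vertices selects one dart of each edge: the one that does not
  -- descend. Darts with equal ends are semi-edges, since there are no loops.
  obtain ⟨_, _⟩ := exists_wellFoundedLT P.Vert
  have hS' : ∀ d, P.rev d ∈ S ↔ d ∈ S := fun d => ⟨fun h => P.rev_rev d ▸ hS _ h, hS d⟩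
  have hT' : ∀ d, Q.rev d ∈ T ↔ d ∈ T := fun d => ⟨fun h => Q.rev_rev d ▸ hT _ h, hT d⟩
  let A := {d : P.Dart // P.origin d ≤ P.target d}
  let B := {d : Q.Dart // α.symm (Q.origin d) ≤ α.symm (Q.target d)}
  let a : A → P.Vert × P.Vert × Prop := fun d => (P.origin d.1, P.target d.1, d.1 ∈ S)
  let b : B → P.Vert × P.Vert × Prop :=
    fun d => (α.symm (Q.origin d.1), α.symm (Q.target d.1), d.1 ∈ T)
  -- The selected darts with given ends and given membership in `S` are counted by the neighbour
  -- multisets, so corresponding fibres are equinumerous finite sets.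
  have key : ∀ k, Nonempty ({x // a x = k} ≃ {x // b x = k}) := by
    rintro ⟨v, w, q⟩
    by_cases hvw : v ≤ w
    · let S' : Set P.Dart := if q then S else Sᶜ
      let T' : Set Q.Dart := if q then T else Tᶜ
      have hST : Q.nbrs T' (α v) = (P.nbrs S' v).map α := by
        by_cases hq : q
        · simpa [S', T', hq] using h1 v
        · simpa [S', T', hq] using h2 v
      have hcard : {d | d ∈ S' ∧ P.origin d = v ∧ P.target d = w}.ncard =
          {d | d ∈ T' ∧ Q.origin d = α v ∧ Q.target d = α w}.ncard := by
        rw [← count_nbrs hP, ← count_nbrs hQ, hST, Multiset.count_map_eq_count' _ _ α.injective]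
        congr!
      have e1 : {x // a x = (v, w, q)} ≃ {d | d ∈ S' ∧ P.origin d = v ∧ P.target d = w} :=
        { toFun := fun x => ⟨x.1.1, by
            have := x.2
            simp only [a, Prod.mk.injEq] at this
            obtain ⟨i, j, k⟩ := this
            refine ⟨?_, i, j⟩
            by_cases hq : q <;> simp_all [S']⟩
          invFun := fun x => ⟨⟨x.1, by rw [x.2.2.1, x.2.2.2]; exact hvw⟩, by
            obtain ⟨i, j, k⟩ := x.2
            simp only [a, Prod.mk.injEq]
            refine ⟨j, k, ?_⟩
            by_cases hq : q <;> simp_all [S']⟩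
          left_inv := fun x => rfl
          right_inv := fun x => rfl }
      have e2 : {x // b x = (v, w, q)} ≃ {d | d ∈ T' ∧ Q.origin d = α v ∧ Q.target d = α w} :=
        { toFun := fun x => ⟨x.1.1, by
            have := x.2
            simp only [b, Prod.mk.injEq, Equiv.symm_apply_eq] at this
            obtain ⟨i, j, k⟩ := this
            refine ⟨?_, i, j⟩
            by_cases hq : q <;> simp_all [T']⟩
          invFun := fun x => ⟨⟨x.1, by rw [x.2.2.1, x.2.2.2]; simpa using hvw⟩, by
            obtain ⟨i, j, k⟩ := x.2
            simp only [b, Prod.mk.injEq, Equiv.symm_apply_eq]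
            refine ⟨j, k, ?_⟩
            by_cases hq : q <;> simp_all [T']⟩
          left_inv := fun x => rfl
          right_inv := fun x => rfl }
      have : Finite {d | d ∈ S' ∧ P.origin d = v ∧ P.target d = w} :=
        ((hP v).subset fun d hd => hd.2.1).to_subtype
      have : Finite {d | d ∈ T' ∧ Q.origin d = α v ∧ Q.target d = α w} :=
        ((hQ (α v)).subset fun d hd => hd.2.1).to_subtype
      exact ⟨(e1.trans (Finite.card_eq.1 hcard).some).trans e2.symm⟩
    · have : IsEmpty {x // a x = (v, w, q)} := ⟨fun x => hvw (by
        have := x.2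
        simp only [a, Prod.mk.injEq] at this
        exact this.1.symm.le.trans (x.1.2.trans this.2.1.le))⟩
      have : IsEmpty {x // b x = (v, w, q)} := ⟨fun x => hvw (by
        have := x.2
        simp only [b, Prod.mk.injEq] at this
        exact this.1.symm.le.trans (x.1.2.trans this.2.1.le))⟩
      exact ⟨Equiv.equivOfIsEmpty _ _⟩
  let ek := fun k => (key k).some
  let e : A ≃ B := ((Equiv.sigmaFiberEquiv a).symm.trans (Equiv.sigmaCongrRight ek)).trans
    (Equiv.sigmaFiberEquiv b)
  have he : ∀ x, b (e x) = a x := fun x => (ek (a x) ⟨x, rfl⟩).2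
  have he1 : ∀ x : A, Q.origin (e x).1 = α (P.origin x.1) := fun x => by
    have := congrArg Prod.fst (he x)
    rwa [Equiv.symm_apply_eq] at this
  have he2 : ∀ x : A, Q.target (e x).1 = α (P.target x.1) := fun x => by
    have := congrArg (fun t => t.2.1) (he x)
    simpa only [a, b, Equiv.symm_apply_eq] using this
  have he3 : ∀ x : A, (e x).1 ∈ T ↔ x.1 ∈ S := fun x =>
    iff_of_eq (congrArg (fun t => t.2.2) (he x))
  have half : ∀ d, ¬ P.origin d ≤ P.target d → P.origin (P.rev d) ≤ P.target (P.rev d) :=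
    fun d hd => by
      rw [target_rev]
      exact (not_le.1 hd).le
  -- The bijection of selected darts is extended to the descending ones by reversal.
  let g : P.Dart → Q.Dart := fun d =>
    if h : P.origin d ≤ P.target d then (e ⟨d, h⟩).1 else Q.rev (e ⟨P.rev d, half d h⟩).1
  have g_pos : ∀ d (h : P.origin d ≤ P.target d), g d = (e ⟨d, h⟩).1 := fun d h => dif_pos h
  have g_neg : ∀ d (h : ¬ P.origin d ≤ P.target d), g d = Q.rev (e ⟨P.rev d, half d h⟩).1 :=
    fun d h => dif_neg h
  have g_origin : ∀ d, Q.origin (g d) = α (P.origin d) := fun d => by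
    by_cases h : P.origin d ≤ P.target d
    · rw [g_pos d h, he1]
    · rw [g_neg d h]
      exact (he2 _).trans (by rw [target_rev])
  have g_rev : ∀ d, Q.rev (g d) = g (P.rev d) := fun d => by
    by_cases h : P.origin d ≤ P.target d
    · rcases h.lt_or_eq with h' | h'
      · have h'' : ¬ P.origin (P.rev d) ≤ P.target (P.rev d) := by
          rw [target_rev]
          exact not_le.2 h'
        rw [g_pos d h, g_neg _ h'']
        simp only [P.rev_rev]
      · rw [lP d h'.symm, g_pos d h]
        refine lQ _ ?_
        rw [he1, he2, h']
    · rw [g_neg d h, Q.rev_rev, g_pos _ (half d h)]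
  have g_target : ∀ d, Q.target (g d) = α (P.target d) := fun d => by
    rw [target, g_rev, g_origin, target]
  have g_mem : ∀ d, g d ∈ T ↔ d ∈ S := fun d => by
    by_cases h : P.origin d ≤ P.target d
    · rw [g_pos d h, he3]
    · rw [g_neg d h, hT', he3, hS']
  have g_inj : Function.Injective g := fun d d' hdd => by
    have o : P.origin d = P.origin d' := α.injective (by rw [← g_origin, hdd, g_origin])
    have t : P.target d = P.target d' := α.injective (by rw [← g_target, hdd, g_target])
    by_cases h : P.origin d ≤ P.target d
    · rw [g_pos d h, g_pos d' (o ▸ t ▸ h)] at hdd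
      exact congrArg Subtype.val (e.injective (Subtype.ext hdd))
    · rw [g_neg d h, g_neg d' (o ▸ t ▸ h)] at hdd
      have h3 := congrArg Q.rev hdd
      rw [Q.rev_rev, Q.rev_rev] at h3
      have h4 := congrArg P.rev (congrArg Subtype.val (e.injective (Subtype.ext h3)))
      simpa only [P.rev_rev] using h4
  have g_half : ∀ y, α.symm (Q.origin y) ≤ α.symm (Q.target y) → ∃ d, g d = y := fun y hy => by
    refine ⟨(e.symm ⟨y, hy⟩).1, ?_⟩
    rw [g_pos _ (e.symm ⟨y, hy⟩).2]
    simp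
  have g_surj : Function.Surjective g := fun y => by
    by_cases h : α.symm (Q.origin y) ≤ α.symm (Q.target y)
    · exact g_half y h
    · obtain ⟨d, hd⟩ := g_half (Q.rev y) (by rw [target_rev]; exact (not_le.1 h).le)
      exact ⟨P.rev d, by rw [← g_rev, hd, Q.rev_rev]⟩
  refine ⟨⟨α, Equiv.ofBijective g ⟨g_inj, g_surj⟩, g_origin, g_rev⟩, ?_⟩
  ext y
  obtain ⟨d, rfl⟩ := g_surj y
  rw [g_mem]
  exact g_inj.mem_set_image

/-! ### The matching outside a 2-factor -/

theorem TwoFactor.rev_mem_compl (F : P.TwoFactor) (d : P.Dart) (h : d ∈ F.dartsᶜ) :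
    P.rev d ∈ F.dartsᶜ := fun h' => h (P.rev_rev d ▸ F.rev_mem _ h')

theorem TwoFactor.exists_dartsAt_compl (hP : P.IsCubic) (F : P.TwoFactor) (v : P.Vert) :
    ∃ d, P.dartsAt F.dartsᶜ v = {d} := by
  rw [← Set.encard_eq_one]
  have h1 : (P.dartsAt F.darts v).encard = 2 := F.degree_eq v
  have h2 : P.dartsAt F.dartsᶜ v = {d | P.origin d = v} \ P.dartsAt F.darts v := by
    ext d
    simp only [dartsAt, Set.mem_ofPred_eq, Set.mem_compl_iff, Set.mem_sdiff]
    tauto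
  have h3 : P.dartsAt F.darts v ⊆ {d | P.origin d = v} := fun d hd => hd.2
  have h4 := Set.encard_sdiff_add_encard_of_subset h3
  rw [← h2, h1, hP v] at h4
  rw [show (3 : ℕ∞) = 1 + 2 from rfl] at h4
  exact (ENat.add_left_injective_of_ne_top (by simp)) h4

theorem TwoFactor.exists_nbrs_eq_pair (F : P.TwoFactor) (v : P.Vert) :
    ∃ x y, P.nbrs F.darts v = {x, y} := by
  obtain ⟨d, e, hde, h⟩ := Set.encard_eq_two.1 (F.degree_eq v)
  exact ⟨_, _, nbrs_pair h hde⟩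

/-- The vertex that is joined to `v` by the edge outside the 2-factor. -/
noncomputable def TwoFactor.partner (F : P.TwoFactor) (hP : P.IsCubic) (v : P.Vert) : P.Vert :=
  P.target (F.exists_dartsAt_compl hP v).choose

theorem TwoFactor.nbrs_compl (F : P.TwoFactor) (hP : P.IsCubic) (v : P.Vert) :
    P.nbrs F.dartsᶜ v = {F.partner hP v} :=
  nbrs_singleton (F.exists_dartsAt_compl hP v).choose_spec

theorem TwoFactor.nbrs_univ (F : P.TwoFactor) (hP : P.IsCubic) (v : P.Vert) :
    P.nbrs Set.univ v = F.partner hP v ::ₘ P.nbrs F.darts v := by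
  rw [← nbrs_add_compl hP.locallyFinite F.darts, F.nbrs_compl hP, Multiset.singleton_add]

theorem mem_nbrs_comm (hP : P.LocallyFinite) {S : Set P.Dart} (hS : ∀ d, d ∈ S → P.rev d ∈ S)
    {v w : P.Vert} : w ∈ P.nbrs S v ↔ v ∈ P.nbrs S w := by
  classical
  rw [← Multiset.count_pos, ← Multiset.count_pos, count_nbrs_comm hP hS]

theorem TwoFactor.partner_partner (F : P.TwoFactor) (hP : P.IsCubic) (v : P.Vert) :
    F.partner hP (F.partner hP v) = v := by
  have h : F.partner hP v ∈ P.nbrs F.dartsᶜ v := by simp [F.nbrs_compl hP]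
  rw [mem_nbrs_comm hP.locallyFinite F.rev_mem_compl, F.nbrs_compl hP, Multiset.mem_singleton] at h
  exact h.symm

theorem TwoFactor.locallyFinite (F : P.TwoFactor) (v : P.Vert) : (P.dartsAt F.darts v).Finite :=
  Set.finite_of_encard_eq_coe (k := 2) (F.degree_eq v)

theorem TwoFactor.component_locallyFinite (F : P.TwoFactor) (v : P.Vert) :
    (F.toPregraph.component v).LocallyFinite := fun w => by
  refine Set.Finite.of_finite_image (f := fun d : (F.toPregraph.component v).Dart => d.1.1)
    ((F.locallyFinite w.1).subset ?_)
    (fun d _ e _ (h : d.1.1 = e.1.1) => Subtype.ext (Subtype.ext h))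
  rintro _ ⟨d, hd, rfl⟩
  exact ⟨d.1.2, congrArg Subtype.val hd⟩

theorem TwoFactor.nbrs_component (F : P.TwoFactor) (v : P.Vert)
    (w : (F.toPregraph.component v).Vert) :
    P.nbrs F.darts w.1 = ((F.toPregraph.component v).nbrs Set.univ w).map Subtype.val := by
  refine nbrs_map (P := P) (Q := F.toPregraph.component v) Subtype.val (fun d => d.1.1)
    ⟨?_, fun d _ e _ h => Subtype.ext (Subtype.ext h), ?_⟩ fun d => rfl
  · rintro d ⟨-, h⟩
    exact ⟨d.1.2, congrArg Subtype.val h⟩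
  · rintro d ⟨h1, h2⟩
    refine ⟨⟨⟨d, h1⟩, ?_⟩, ⟨trivial, Subtype.ext h2⟩, rfl⟩
    change F.toPregraph.Reachable v (P.origin d)
    rw [h2]
    exact w.2

/-! ### Local characterization of the quotients of C₄ -/

/-- The neighbours of `v` and of its neighbours are as in a quotient of the 4-cycle. -/
def IsSquareAt (P : Pregraph) (S : Set P.Dart) (v : P.Vert) : Prop :=
  ∃ x y z, P.nbrs S v = {x, y} ∧ P.nbrs S x = {v, z} ∧ P.nbrs S y = {v, z} ∧ P.nbrs S z = {x, y}

theorem q1_nbrs (i : ZMod 4) : q1.nbrs Set.univ i = {i + 1, i - 1} := by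
  refine nbrs_pair (P := q1) (d := (i, true)) (e := (i, false)) ?_ (by simp)
  ext ⟨j, b⟩
  cases b <;> simp [dartsAt]

theorem q2_nbrs (i : Bool) : q2.nbrs Set.univ i = {!i, !i} := by
  refine nbrs_pair (P := q2) (d := (i, true)) (e := (i, false)) ?_ (by simp)
  ext ⟨j, b⟩
  cases b <;> simp [dartsAt]

theorem q3_nbrs (i : Bool) : q3.nbrs Set.univ i = {!i, i} := by
  refine nbrs_pair (P := q3) (d := (i, true)) (e := (i, false)) ?_ (by simp)
  ext ⟨j, b⟩
  cases b <;> simp [dartsAt]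

theorem q4_nbrs (i : Unit) : q4.nbrs Set.univ i = {(), ()} := by
  refine nbrs_pair (P := q4) (d := true) (e := false) ?_ (by simp)
  ext b
  cases b <;> simp [dartsAt]

theorem q1_isSquareAt (i : ZMod 4) : q1.IsSquareAt Set.univ i := by
  refine ⟨i + 1, i - 1, i + 2, q1_nbrs i, ?_, ?_, ?_⟩
  · rw [q1_nbrs, Multiset.pair_comm]
    congr 1
    · ring
    · congr 1; ring
  · rw [q1_nbrs]
    congr 1
    · ring
    · congr 1
      rw [show (2 : ZMod 4) = -2 from rfl]; ring
  · rw [q1_nbrs, Multiset.pair_comm]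
    congr 1
    · ring
    · congr 1
      rw [show (2 : ZMod 4) = -2 from rfl]; ring

theorem q2_isSquareAt (i : Bool) : q2.IsSquareAt Set.univ i := by
  have h : q2.nbrs Set.univ (!i) = {i, i} := (q2_nbrs (!i)).trans (by rw [Bool.not_not])
  exact ⟨!i, !i, i, q2_nbrs i, h, h, q2_nbrs i⟩

theorem q3_isSquareAt (i : Bool) : q3.IsSquareAt Set.univ i := by
  have h : q3.nbrs Set.univ (!i) = {i, !i} := (q3_nbrs (!i)).trans (by rw [Bool.not_not])
  refine ⟨!i, i, !i, q3_nbrs i, h, ?_, ?_⟩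
  · rw [q3_nbrs, Multiset.pair_comm]
  · rw [h, Multiset.pair_comm]

theorem q4_isSquareAt (i : Unit) : q4.IsSquareAt Set.univ i :=
  ⟨(), (), (), q4_nbrs _, q4_nbrs _, q4_nbrs _, q4_nbrs _⟩

theorem q1_loopless : q1.Loopless := by
  rintro ⟨i, b⟩ h
  exfalso
  revert i b
  decide

theorem q2_loopless : q2.Loopless := by
  rintro ⟨i, b⟩ h
  simp [target] at h

theorem q3_loopless : q3.Loopless := by
  rintro ⟨i, b⟩ h
  cases b <;> simp_all [target]

theorem q4_loopless : q4.Loopless := fun _ _ => rfl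

theorem Iso.isSquareAt (f : Iso P Q) (h : ∀ v, Q.IsSquareAt Set.univ v) (v : P.Vert) :
    P.IsSquareAt Set.univ v := by
  have key : ∀ w, (P.nbrs Set.univ w).map f.vert = Q.nbrs Set.univ (f.vert w) := fun w => by
    rw [← f.nbrs_image, Set.image_univ, f.dart.range_eq_univ]
  have inj := Multiset.map_injective f.vert.injective
  obtain ⟨x, y, z, h1, h2, h3, h4⟩ := h (f.vert v)
  refine ⟨f.vert.symm x, f.vert.symm y, f.vert.symm z, inj ?_, inj ?_, inj ?_, inj ?_⟩ <;>
    rw [key] <;> simp [*]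

theorem Iso.loopless (f : Iso P Q) (h : Q.Loopless) : P.Loopless := fun d hd => by
  apply f.dart.injective
  rw [← f.rev_dart]
  exact h _ (by rw [f.target_dart, hd, f.origin_dart])

theorem IsC4Quotient.isSquareAt (h : P.IsC4Quotient) (v : P.Vert) : P.IsSquareAt Set.univ v := by
  rcases h with ⟨⟨f⟩⟩ | ⟨⟨f⟩⟩ | ⟨⟨f⟩⟩ | ⟨⟨f⟩⟩
  · exact f.isSquareAt q1_isSquareAt v
  · exact f.isSquareAt q2_isSquareAt v
  · exact f.isSquareAt q3_isSquareAt v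
  · exact f.isSquareAt q4_isSquareAt v

theorem IsC4Quotient.loopless (h : P.IsC4Quotient) : P.Loopless := by
  rcases h with ⟨⟨f⟩⟩ | ⟨⟨f⟩⟩ | ⟨⟨f⟩⟩ | ⟨⟨f⟩⟩
  · exact f.loopless q1_loopless
  · exact f.loopless q2_loopless
  · exact f.loopless q3_loopless
  · exact f.loopless q4_loopless

theorem TwoFactor.IsC4QuotientFactor.isSquareAt {F : P.TwoFactor} (hF : F.IsC4QuotientFactor)
    (v : P.Vert) : P.IsSquareAt F.darts v := by
  obtain ⟨x, y, z, h1, h2, h3, h4⟩ := (hF v).isSquareAt ⟨v, Relation.ReflTransGen.refl⟩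
  refine ⟨x.1, y.1, z.1, ?_, ?_, ?_, ?_⟩
  · rw [F.nbrs_component v ⟨v, Relation.ReflTransGen.refl⟩, h1]; simp
  · rw [F.nbrs_component v x, h2]; simp
  · rw [F.nbrs_component v y, h3]; simp
  · rw [F.nbrs_component v z, h4]; simp

/-- A loop inside the factor would lie in a quotient of C₄; a loop outside would give its vertex two
omitted darts instead of one. -/
theorem TwoFactor.IsC4QuotientFactor.loopless {F : P.TwoFactor} (hP : P.IsCubic)
    (hF : F.IsC4QuotientFactor) : P.Loopless := fun d hd => by
  by_cases h : d ∈ F.darts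
  · have := (hF (P.origin d)).loopless ⟨⟨d, h⟩, Relation.ReflTransGen.refl⟩ (Subtype.ext hd)
    exact congrArg (fun e => e.1.1) this
  · obtain ⟨e, he⟩ := F.exists_dartsAt_compl hP (P.origin d)
    have h1 : d ∈ P.dartsAt F.dartsᶜ (P.origin d) := ⟨h, rfl⟩
    have h2 : P.rev d ∈ P.dartsAt F.dartsᶜ (P.origin d) := ⟨F.rev_mem_compl _ h, hd⟩
    rw [he] at h1 h2
    exact (Set.mem_singleton_iff.1 h2).trans (Set.mem_singleton_iff.1 h1).symm

/-- A closed set of vertices contains the component. -/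
theorem Reachable.mem_of_closed {v : P.Vert} {s : Set P.Vert} (hv : v ∈ s)
    (hs : ∀ d, P.origin d ∈ s → P.target d ∈ s) {w : P.Vert} (h : P.Reachable v w) : w ∈ s := by
  induction h with
  | refl => exact hv
  | tail _ h ih =>
    obtain ⟨d, rfl, rfl⟩ := h
    exact hs d ih

theorem mem_nbrs (hP : P.LocallyFinite) {S : Set P.Dart} {v w : P.Vert} :
    w ∈ P.nbrs S v ↔ ∃ d ∈ S, P.origin d = v ∧ P.target d = w := by
  rw [nbrs, dif_pos (hP.dartsAt _ _)]
  simp [dartsAt, and_assoc]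

/-- A pregraph with the neighbourhoods of `Q` in the component of `v` is isomorphic to `Q`. -/
theorem TwoFactor.component_isomorphic (hP : P.Loopless) (F : P.TwoFactor) (v : P.Vert)
    (hQ : Q.LocallyFinite) (lQ : Q.Loopless) (α : Q.Vert → P.Vert) (hα : Function.Injective α)
    (i : Q.Vert) (hi : α i = v)
    (h : ∀ j, P.nbrs F.darts (α j) = (Q.nbrs Set.univ j).map α) (hfin : P.LocallyFinite)
    (hc : ∀ j, Q.Reachable i j) : (F.toPregraph.component v).Isomorphic Q := by
  have h1 : ∀ w, F.toPregraph.Reachable v w → w ∈ Set.range α := fun w hw => by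
    refine Reachable.mem_of_closed (P := F.toPregraph) (s := Set.range α) ⟨i, hi⟩ ?_ hw
    rintro ⟨d, hd⟩ ⟨j, hj⟩
    have : P.target d ∈ P.nbrs F.darts (α j) := (mem_nbrs hfin).2 ⟨d, hd, hj.symm, rfl⟩
    rw [h, Multiset.mem_map] at this
    obtain ⟨k, -, hk⟩ := this
    exact ⟨k, hk⟩
  have h2 : ∀ j, F.toPregraph.Reachable v (α j) := fun j => by
    have : j ∈ {j | F.toPregraph.Reachable v (α j)} := by
      refine Reachable.mem_of_closed (P := Q) (v := i) ?_ ?_ (hc j)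
      · rw [Set.mem_ofPred_eq, hi]
        exact Relation.ReflTransGen.refl
      · intro d hd
        have h3 : α (Q.target d) ∈ P.nbrs F.darts (α (Q.origin d)) := by
          rw [h]
          exact Multiset.mem_map_of_mem _ ((mem_nbrs hQ).2 ⟨d, trivial, rfl, rfl⟩)
        obtain ⟨e, he, h4, h5⟩ := (mem_nbrs hfin).1 h3
        exact Relation.ReflTransGen.tail hd ⟨⟨e, he⟩, h4, h5⟩
    exact this
  let β : Q.Vert ≃ (F.toPregraph.component v).Vert :=
    Equiv.ofBijective (fun j => ⟨α j, h2 j⟩)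
      ⟨fun j k hjk => hα (congrArg Subtype.val hjk), fun w => by
        obtain ⟨j, hj⟩ := h1 w.1 w.2
        exact ⟨j, Subtype.ext hj⟩⟩
  have lC : (F.toPregraph.component v).Loopless := by
    rintro ⟨⟨d, hd⟩, hr⟩ h
    exact Subtype.ext (Subtype.ext (hP d (congrArg Subtype.val h)))
  obtain ⟨f, -⟩ := exists_iso (P := Q) (Q := F.toPregraph.component v) hQ
    (F.component_locallyFinite v) lQ lC (S := Set.univ) (T := Set.univ) (by simp) (by simp) β
    (fun j => by
      apply Multiset.map_injective Subtype.val_injective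
      rw [← F.nbrs_component, Multiset.map_map]
      exact h j)
    (fun j => by rw [Set.compl_univ, Set.compl_univ, nbrs_empty, nbrs_empty, Multiset.map_zero])
  exact Isomorphic.symm ⟨f⟩

/-- In a loopless pregraph, the local condition characterizes the quotients of the 4-cycle. -/
theorem TwoFactor.isC4QuotientFactor_of_isSquareAt (hfin : P.LocallyFinite) (hP : P.Loopless)
    (F : P.TwoFactor) (h : ∀ v, P.IsSquareAt F.darts v) : F.IsC4QuotientFactor := fun v => by
  classical
  -- A vertex that is its own neighbour lies in a component of type `q3` or `q4`.
  have key : ∀ y z, P.nbrs F.darts v = {v, y} → P.nbrs F.darts v = {v, z} →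
      P.nbrs F.darts y = {v, z} → (F.toPregraph.component v).IsC4Quotient := by
    intro y z h1 h2 h3
    have hyz : y = z := by
      rw [h1] at h2
      simpa using h2
    subst hyz
    by_cases hy : y = v
    · subst hy
      refine Or.inr (Or.inr (Or.inr ?_))
      refine F.component_isomorphic hP y (Q := q4) (fun _ => Set.toFinite _) q4_loopless
        (fun _ => y) (fun _ _ _ => rfl) () rfl (fun j => ?_) hfin fun _ => .refl
      rw [q4_nbrs, h1]
      simp
    · refine Or.inr (Or.inr (Or.inl ?_))
      refine F.component_isomorphic hP v (Q := q3) (fun _ => Set.toFinite _) q3_loopless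
        (fun b : Bool => if b then y else v) ?_ false rfl ?_ hfin ?_
      · rintro (_ | _) (_ | _) <;> simp [hy, Ne.symm hy]
      · rintro (_ | _)
        · rw [q3_nbrs]
          simpa using h1.trans (Multiset.pair_comm _ _)
        · rw [q3_nbrs]
          simpa using h3
      · rintro (_ | _)
        · exact .refl
        · exact .single ⟨(false, true), rfl, rfl⟩
  obtain ⟨x, y, z, h1, h2, h3, h4⟩ := h v
  by_cases hx : x = v
  · subst hx
    exact key y z h1 h2 h3
  by_cases hy : y = v
  · subst hy
    exact key x z (by rw [h1, Multiset.pair_comm]) h3 h2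
  -- Counting the edges between `v` and `x` from both sides decides whether `z = v`: this holds
  -- exactly if `x = y`, which separates `q2` from `q1`.
  have hcount := count_nbrs_comm hfin F.rev_mem v x
  by_cases hxy : x = y
  · subst hxy
    have hz : z = v := by
      by_contra hz
      rw [h1, h2] at hcount
      simp [Ne.symm hz] at hcount
    subst hz
    refine Or.inr (Or.inl ?_)
    refine F.component_isomorphic hP z (Q := q2) (fun _ => Set.toFinite _) q2_loopless
      (fun b : Bool => if b then x else z) ?_ false rfl ?_ hfin ?_
    · rintro (_ | _) (_ | _) <;> simp [hx, Ne.symm hx]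
    · rintro (_ | _)
      · rw [q2_nbrs]
        simpa using h1
      · rw [q2_nbrs]
        simpa using h2
    · rintro (_ | _)
      · exact .refl
      · exact .single ⟨(false, true), rfl, rfl⟩
  have hzv : z ≠ v := by
    rintro rfl
    rw [h1, h2] at hcount
    simp [hxy] at hcount
  have hzx : z ≠ x := by
    rintro rfl
    rw [h2, Multiset.pair_comm] at h4
    exact hy (by simpa using h4.symm)
  have hzy : z ≠ y := by
    rintro rfl
    rw [h3, Multiset.pair_comm, Multiset.pair_comm x] at h4
    exact hx (by simpa using h4.symm)
  refine Or.inl ?_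
  obtain ⟨α, a0, a1, a2, a3⟩ : ∃ α : ZMod 4 → P.Vert, α 0 = v ∧ α 1 = x ∧ α 2 = z ∧ α 3 = y :=
    ⟨(![v, x, z, y] : Fin 4 → P.Vert), rfl, rfl, rfl, rfl⟩
  have hi : ∀ i : ZMod 4, i = 0 ∨ i = 1 ∨ i = 2 ∨ i = 3 := by decide
  have map_nbrs : ∀ i j k : ZMod 4, i + 1 = j → i - 1 = k →
      (q1.nbrs Set.univ i).map α = {α j, α k} := by
    rintro i _ _ rfl rfl
    rw [q1_nbrs]
    simp
  refine F.component_isomorphic hP v (Q := q1) (fun _ => Set.toFinite _) q1_loopless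
    α ?_ 0 a0 ?_ hfin ?_
  · intro i j hij
    rcases hi i with rfl | rfl | rfl | rfl <;> rcases hi j with rfl | rfl | rfl | rfl <;>
      grind
  · intro i
    rcases hi i with rfl | rfl | rfl | rfl
    · rw [map_nbrs 0 1 3 (by decide) (by decide), a0, a1, a3, h1]
    · rw [map_nbrs 1 2 0 (by decide) (by decide), a0, a1, a2, h2, Multiset.pair_comm]
    · rw [map_nbrs 2 3 1 (by decide) (by decide), a1, a2, a3, h4, Multiset.pair_comm]
    · rw [map_nbrs 3 0 2 (by decide) (by decide), a0, a2, a3, h3]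
  · intro i
    have s : ∀ j k : ZMod 4, j + 1 = k → q1.Adj j k := by
      rintro j _ rfl
      exact ⟨(j, true), rfl, rfl⟩
    have s1 := s 0 1 (by decide)
    have s2 := s 1 2 (by decide)
    have s3 := s 2 3 (by decide)
    rcases hi i with rfl | rfl | rfl | rfl
    · exact .refl
    · exact .single s1
    · exact .tail (.single s1) s2
    · exact .tail (.tail (.single s1) s2) s3

/-! ### Comparing two factors: three commuting involutions -/

theorem triple_eq_cases {α : Type*} {a b c a' b' c' : α}
    (h : ({a, b, c} : Multiset α) = {a', b', c'}) :
    (a = a' ∧ b = b' ∧ c = c') ∨ (a = a' ∧ b = c' ∧ c = b') ∨ (a = b' ∧ b = a' ∧ c = c') ∨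
      (a = b' ∧ b = c' ∧ c = a') ∨ (a = c' ∧ b = a' ∧ c = b') ∨ (a = c' ∧ b = b' ∧ c = a') := by
  classical
  have ha : a ∈ ({a', b', c'} : Multiset α) := h ▸ by simp
  have pair : ∀ {p q r s : α}, ({p, q} : Multiset α) = {r, s} → (p = r ∧ q = s) ∨ (p = s ∧ q = r) :=
    fun {p q r s} h => by
      have hp : p ∈ ({r, s} : Multiset α) := h ▸ by simp
      simp only [Multiset.insert_eq_cons, Multiset.mem_cons, Multiset.mem_singleton] at hp
      rcases hp with rfl | rfl
      · left
        simpa using h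
      · right
        rw [Multiset.pair_comm r] at h
        simpa using h
  simp only [Multiset.insert_eq_cons, Multiset.mem_cons, Multiset.mem_singleton] at ha
  rcases ha with rfl | rfl | rfl
  · have h' : ({b, c} : Multiset α) = {b', c'} := by simpa using h
    rcases pair h' with ⟨rfl, rfl⟩ | ⟨rfl, rfl⟩ <;> simp
  · have h' : ({b, c} : Multiset α) = {a', c'} := by
      simp only [Multiset.insert_eq_cons] at h ⊢
      rw [Multiset.cons_swap a'] at h
      simpa using h
    rcases pair h' with ⟨rfl, rfl⟩ | ⟨rfl, rfl⟩ <;> simp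
  · have h' : ({b, c} : Multiset α) = {a', b'} := by
      simp only [Multiset.insert_eq_cons, ← Multiset.cons_zero] at h ⊢
      rw [Multiset.cons_swap b', Multiset.cons_swap a'] at h
      simpa using h
    rcases pair h' with ⟨rfl, rfl⟩ | ⟨rfl, rfl⟩ <;> simp

theorem pair_eq_cases {α : Type*} {a b a' b' : α} (h : ({a, b} : Multiset α) = {a', b'}) :
    (a = a' ∧ b = b') ∨ (a = b' ∧ b = a') := by
  have h' : ({a, a, b} : Multiset α) = {a, a', b'} := by
    rw [Multiset.insert_eq_cons, h, ← Multiset.insert_eq_cons]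
  rcases triple_eq_cases h' with h | h | h | h | h | h <;> grind

/-- Three involutions of the vertex set describing the edges of a cubic pregraph, the third of which
commutes with the others. -/
structure IsCommutingTriple (P : Pregraph) (φ ψ χ : P.Vert → P.Vert) : Prop where
  invol₁ : ∀ v, φ (φ v) = v
  invol₂ : ∀ v, ψ (ψ v) = v
  invol₃ : ∀ v, χ (χ v) = v
  comm₁ : ∀ v, χ (φ v) = φ (χ v)
  comm₂ : ∀ v, χ (ψ v) = ψ (χ v)
  nbrs_eq : ∀ v, P.nbrs Set.univ v = {φ v, ψ v, χ v}

theorem IsCommutingTriple.swap {φ ψ χ : P.Vert → P.Vert} (h : P.IsCommutingTriple φ ψ χ) :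
    P.IsCommutingTriple ψ φ χ :=
  ⟨h.invol₂, h.invol₁, h.invol₃, h.comm₂, h.comm₁, fun v => by
    rw [h.nbrs_eq]
    exact Multiset.cons_swap _ _ _⟩

/-- A permutation of the vertices that preserves multiplicities of edges and maps the edges outside
`F` to those outside `G` is induced by an automorphism. -/
theorem TwoFactor.isomorphic_of_equiv (hP : P.IsCubic) (lP : P.Loopless) (F G : P.TwoFactor)
    (α : P.Vert ≃ P.Vert)
    (h1 : ∀ v, P.nbrs Set.univ (α v) = (P.nbrs Set.univ v).map α)
    (h2 : ∀ v, G.partner hP (α v) = α (F.partner hP v)) : F.Isomorphic G := by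
  refine exists_iso hP.locallyFinite hP.locallyFinite lP lP F.rev_mem G.rev_mem α (fun v => ?_)
    fun v => by rw [F.nbrs_compl hP, G.nbrs_compl hP, h2, Multiset.map_singleton]
  have := h1 v
  rw [G.nbrs_univ hP, F.nbrs_univ hP, Multiset.map_cons, h2] at this
  exact (Multiset.cons_inj_right _).1 this

section Compare

variable {F G : P.TwoFactor} (hP : P.IsCubic)

/-- Each factor deletes one entry from the same multiset of three neighbours. As the deleted entries
differ, exactly one entry `c` is left to both. -/
theorem TwoFactor.exists_third {v : P.Vert} (hv : F.partner hP v ≠ G.partner hP v) :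
    ∃ c, P.nbrs F.darts v = {G.partner hP v, c} ∧ P.nbrs G.darts v = {F.partner hP v, c} := by
  obtain ⟨x, y, hxy⟩ := F.exists_nbrs_eq_pair v
  obtain ⟨z, t, hzt⟩ := G.exists_nbrs_eq_pair v
  have h : ({F.partner hP v, x, y} : Multiset P.Vert) = {G.partner hP v, z, t} := by
    have h1 := F.nbrs_univ hP v
    have h2 := G.nbrs_univ hP v
    rw [hxy] at h1
    rw [hzt] at h2
    exact h1.symm.trans h2
  rw [hxy, hzt]
  rcases triple_eq_cases h with ⟨i, j, k⟩ | ⟨i, j, k⟩ | ⟨i, j, k⟩ | ⟨i, j, k⟩ | ⟨i, j, k⟩ | ⟨i, j, k⟩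
  · exact absurd i hv
  · exact absurd i hv
  · exact ⟨y, by rw [j], by rw [i, k]⟩
  · exact ⟨x, by rw [k, Multiset.pair_comm], by rw [i, j]⟩
  · exact ⟨y, by rw [j], by rw [i, k, Multiset.pair_comm]⟩
  · exact ⟨x, by rw [k, Multiset.pair_comm], by rw [i, j, Multiset.pair_comm]⟩

theorem TwoFactor.partner_ne_partner {v : P.Vert} (hv : F.partner hP v ≠ G.partner hP v) :
    F.partner hP (G.partner hP v) ≠ G.partner hP (G.partner hP v) := fun h => by
  rw [G.partner_partner] at h
  apply hv
  rw [← F.partner_partner hP (G.partner hP v), h]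

theorem TwoFactor.square_of_third (hF : ∀ v, P.IsSquareAt F.darts v) {v c : P.Vert}
    (h1 : P.nbrs F.darts v = {G.partner hP v, c}) :
    ∃ z, P.nbrs F.darts (G.partner hP v) = {v, z} ∧ P.nbrs F.darts c = {v, z} ∧
      P.nbrs F.darts z = {G.partner hP v, c} := by
  obtain ⟨x, y, z, i, j, k, l⟩ := hF v
  rw [h1] at i
  rcases pair_eq_cases i with ⟨rfl, rfl⟩ | ⟨rfl, rfl⟩
  · exact ⟨z, j, k, l⟩
  · exact ⟨z, k, j, by rw [l, Multiset.pair_comm]⟩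

/-- The common edge at a vertex where two factors differ. -/
theorem TwoFactor.third_spec (hF : ∀ v, P.IsSquareAt F.darts v)
    (hG : ∀ v, P.IsSquareAt G.darts v) {v c : P.Vert} (hv : F.partner hP v ≠ G.partner hP v)
    (h1 : P.nbrs F.darts v = {G.partner hP v, c}) (h2 : P.nbrs G.darts v = {F.partner hP v, c}) :
    F.partner hP c ≠ G.partner hP c ∧ P.nbrs F.darts c = {v, G.partner hP c} ∧
      P.nbrs F.darts (G.partner hP v) = {v, G.partner hP c} ∧
      P.nbrs G.darts (F.partner hP v) = {v, F.partner hP c} := by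
  classical
  obtain ⟨z, i1, i2, i3⟩ := TwoFactor.square_of_third hP hF h1
  obtain ⟨t, j1, j2, j3⟩ := TwoFactor.square_of_third hP hG h2
  have hc : ({F.partner hP c, z} : Multiset P.Vert) = {G.partner hP c, t} := by
    have k1 := F.nbrs_univ hP c
    rw [G.nbrs_univ hP c, i2, j2, Multiset.insert_eq_cons, Multiset.insert_eq_cons,
      Multiset.cons_swap, Multiset.cons_swap _ v] at k1
    exact ((Multiset.cons_inj_right _).1 k1).symm
  -- If the partners of `c` agreed, both squares would have the same fourth vertex. Comparing its
  -- neighbours makes that vertex equal to `v`, and counting edges then identifies both partners of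
  -- `v` with `c`.
  have hne : F.partner hP c ≠ G.partner hP c := fun h => by
    have hzt : z = t := by
      rw [h] at hc
      simpa using hc
    subst hzt
    have k1 := F.nbrs_univ hP z
    rw [G.nbrs_univ hP z, i3, j3] at k1
    have hzv : z = v := by
      have k2 : ({G.partner hP z, F.partner hP v, c} : Multiset P.Vert) =
        {F.partner hP z, G.partner hP v, c} := k1
      have e1 := F.partner_partner hP z
      have e2 := F.partner_partner hP v
      have e3 := G.partner_partner hP z
      have e4 := G.partner_partner hP v
      rcases triple_eq_cases k2 with h | h | h | h | h | h <;> grind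
    subst hzv
    have c1 := count_nbrs_comm hP.locallyFinite F.rev_mem (G.partner hP z) z
    have c2 := count_nbrs_comm hP.locallyFinite G.rev_mem (F.partner hP z) z
    rw [h1, i1] at c1
    rw [h2, j1] at c2
    have d1 : c = G.partner hP z := by
      by_contra h
      simp [Ne.symm h] at c1
    have d2 : c = F.partner hP z := by
      by_contra h
      simp [Ne.symm h] at c2
    exact hv (d2.symm.trans d1)
  rcases pair_eq_cases hc with ⟨h, -⟩ | ⟨h, h'⟩
  · exact absurd h hne
  · rw [h, ← h']
    exact ⟨h' ▸ h ▸ hne, i2, i1, j1⟩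

/-- Two factors that differ at some vertex, up to parallel edges, come from three matchings. -/
theorem TwoFactor.exists_isCommutingTriple (hc : P.IsConnected)
    (hF : ∀ v, P.IsSquareAt F.darts v) (hG : ∀ v, P.IsSquareAt G.darts v) {v₀ : P.Vert}
    (hv₀ : F.partner hP v₀ ≠ G.partner hP v₀) :
    (∀ v, F.partner hP v ≠ G.partner hP v) ∧
      ∃ χ, P.IsCommutingTriple (F.partner hP) (G.partner hP) χ := by
  -- Disagreement propagates along all three edges at a vertex, hence everywhere by connectedness.
  have hall : ∀ v, F.partner hP v ≠ G.partner hP v := fun v => by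
    refine Reachable.mem_of_closed (s := {v | F.partner hP v ≠ G.partner hP v}) hv₀ ?_ (hc.2 v₀ v)
    intro d hd
    obtain ⟨c, h1, h2⟩ := TwoFactor.exists_third hP hd
    have h3 : P.target d ∈ P.nbrs Set.univ (P.origin d) :=
      (mem_nbrs hP.locallyFinite).2 ⟨d, trivial, rfl, rfl⟩
    rw [F.nbrs_univ hP, h1] at h3
    simp only [Multiset.insert_eq_cons, Multiset.mem_cons, Multiset.mem_singleton] at h3
    rcases h3 with h3 | h3 | h3
    · rw [h3]
      exact (TwoFactor.partner_ne_partner hP hd.symm).symm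
    · rw [h3]
      exact TwoFactor.partner_ne_partner hP hd
    · rw [h3]
      exact (TwoFactor.third_spec hP hF hG hd h1 h2).1
  choose χ h1 h2 using fun v => TwoFactor.exists_third hP (hall v)
  -- The square of `F` at `v` has the vertices v, ψ v, χ v and ψ (χ v), so χ commutes with ψ; the
  -- square of `G` gives the same for φ.
  have spec := fun v => TwoFactor.third_spec hP hF hG (hall v) (h1 v) (h2 v)
  refine ⟨hall, χ, F.partner_partner hP, G.partner_partner hP, fun v => ?_, fun v => ?_, fun v => ?_,
    fun v => ?_⟩
  · have := (spec v).2.1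
    rw [h1, Multiset.pair_comm] at this
    simpa using this
  · have := (spec v).2.2.2
    rw [h2, F.partner_partner] at this
    simpa using this
  · have := (spec v).2.2.1
    rw [h1, G.partner_partner] at this
    simpa using this
  · rw [F.nbrs_univ hP, h1]
    rfl

end Compare

/-! ### Alternating walks and their symmetries -/

/-- Apply `χ` or not. -/
def twist {V : Type*} (χ : V → V) (s : Bool) (v : V) : V := if s then χ v else v

/-- A two-sided walk that uses `φ` and `ψ` alternately. -/
structure IsAlternatingWalk {V : Type*} (φ ψ : V → V) (p : ℤ → V) : Prop where
  even : ∀ i, Even i → φ (p i) = p (i + 1)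
  odd : ∀ i, Odd i → ψ (p i) = p (i + 1)

/-- Even positions carry the integer powers of ψ ∘ φ applied to `v`, odd positions their φ-images.
-/
theorem exists_isAlternatingWalk {V : Type*} {φ ψ : V → V} (hφ : ∀ v, φ (φ v) = v)
    (hψ : ∀ v, ψ (ψ v) = v) (v : V) : ∃ p : ℤ → V, p 0 = v ∧ IsAlternatingWalk φ ψ p := by
  let f : Equiv.Perm V := ⟨φ, φ, hφ, hφ⟩
  let g : Equiv.Perm V := ⟨ψ, ψ, hψ, hψ⟩
  refine ⟨fun i => if Even i then ((g * f) ^ (i / 2)) v else f (((g * f) ^ (i / 2)) v), by simp,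
    ⟨fun i hi => ?_, fun i hi => ?_⟩⟩
  · have h1 : ¬ Even (i + 1) := by grind
    have h2 : (i + 1) / 2 = i / 2 := by grind
    simp only [hi, h1, if_true, if_false, h2]
    rfl
  · have h1 : ¬ Even i := by grind
    have h3 : Even (i + 1) := by grind
    have h2 : (i + 1) / 2 = 1 + i / 2 := by grind
    simp only [h3, h1, if_true, if_false, h2, zpow_add, zpow_one]
    rfl

namespace IsAlternatingWalk

variable {V : Type*} {φ ψ χ : V → V} {p : ℤ → V}

theorem shift_even (h : IsAlternatingWalk φ ψ p) {k : ℤ} (hk : Even k) :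
    IsAlternatingWalk φ ψ fun i => p (i + k) :=
  ⟨fun i hi => by rw [h.even _ (hi.add hk)]; congr 1; ring,
    fun i hi => by rw [h.odd _ (hi.add_even hk)]; congr 1; ring⟩

theorem shift_odd (h : IsAlternatingWalk φ ψ p) {k : ℤ} (hk : Odd k) :
    IsAlternatingWalk ψ φ fun i => p (i + k) :=
  ⟨fun i hi => by rw [h.odd _ (hi.add_odd hk)]; congr 1; ring,
    fun i hi => by rw [h.even _ (hi.add_odd hk)]; congr 1; ring⟩

end IsAlternatingWalk

theorem twist_twist {V : Type*} {χ : V → V} (hχ : ∀ v, χ (χ v) = v) (s t : Bool) (v : V) :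
    twist χ s (twist χ t v) = twist χ (s ^^ t) v := by
  cases s <;> cases t <;> simp [twist, hχ]

theorem twist_comm {V : Type*} {χ f : V → V} (hf : ∀ v, χ (f v) = f (χ v)) (s : Bool) (v : V) :
    twist χ s (f v) = f (twist χ s v) := by
  cases s <;> simp [twist, hf]

theorem twist_injective {V : Type*} {χ : V → V} (hχ : ∀ v, χ (χ v) = v) (s : Bool) :
    Function.Injective (twist χ s) := fun v w h => by
  have := congrArg (twist χ s) h
  rwa [twist_twist hχ, twist_twist hχ, Bool.xor_self] at this

namespace IsCommutingTriple

variable {φ ψ χ : P.Vert → P.Vert} {p : ℤ → P.Vert}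

theorem walk₁ (h : P.IsCommutingTriple φ ψ χ) (hp : IsAlternatingWalk φ ψ p) (i : ℤ) :
    φ (p i) = p (if Even i then i + 1 else i - 1) := by
  split_ifs with hi
  · exact hp.even i hi
  · have : φ (p (i - 1)) = p i := by
      rw [hp.even _ (by grind)]
      congr 1
      ring
    rw [← this, h.invol₁]

theorem walk₂ (h : P.IsCommutingTriple φ ψ χ) (hp : IsAlternatingWalk φ ψ p) (i : ℤ) :
    ψ (p i) = p (if Even i then i - 1 else i + 1) := by
  split_ifs with hi
  · have : ψ (p (i - 1)) = p i := by
      rw [hp.odd _ (by grind)]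
      congr 1
      ring
    rw [← this, h.invol₂]
  · exact hp.odd i (Int.not_even_iff_odd.1 hi)

theorem nbrs_walk (h : P.IsCommutingTriple φ ψ χ) (hp : IsAlternatingWalk φ ψ p) (s : Bool)
    (i : ℤ) : P.nbrs Set.univ (twist χ s (p i)) =
      {twist χ (!s) (p i), twist χ s (p (i - 1)), twist χ s (p (i + 1))} := by
  rw [h.nbrs_eq, ← twist_comm h.comm₁, ← twist_comm h.comm₂, h.walk₁ hp, h.walk₂ hp]
  have e : χ (twist χ s (p i)) = twist χ (!s) (p i) := by cases s <;> simp [twist, h.invol₃]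
  rw [e]
  simp only [Multiset.insert_eq_cons, ← Multiset.cons_zero]
  split_ifs
  · rw [Multiset.cons_swap _ (twist χ (!s) (p i)), Multiset.cons_swap _ (twist χ (!s) (p i)),
      Multiset.cons_swap (twist χ s (p (i + 1)))]
  · rw [Multiset.cons_swap _ (twist χ (!s) (p i)), Multiset.cons_swap _ (twist χ (!s) (p i))]

/-- A set of vertices closed under the three involutions is everything. -/
theorem forall_mem (h : P.IsCommutingTriple φ ψ χ) (hc : P.IsConnected) (hf : P.LocallyFinite)
    {s : Set P.Vert} {v₀ : P.Vert} (hv₀ : v₀ ∈ s) (h₁ : ∀ v ∈ s, φ v ∈ s) (h₂ : ∀ v ∈ s, ψ v ∈ s)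
    (h₃ : ∀ v ∈ s, χ v ∈ s) (v : P.Vert) : v ∈ s := by
  refine Reachable.mem_of_closed hv₀ (fun d hd => ?_) (hc.2 v₀ v)
  have := (mem_nbrs hf (S := Set.univ)).2 ⟨d, trivial, rfl, rfl⟩
  rw [h.nbrs_eq] at this
  simp only [Multiset.insert_eq_cons, Multiset.mem_cons, Multiset.mem_singleton] at this
  rcases this with e | e | e <;> rw [e]
  · exact h₁ _ hd
  · exact h₂ _ hd
  · exact h₃ _ hd

theorem twist_third (h : P.IsCommutingTriple φ ψ χ) (s : Bool) (v : P.Vert) :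
    χ (twist χ s v) = twist χ (!s) v := by
  cases s <;> simp [twist, h.invol₃]

/-- By commutation, the walk together with its χ-image is closed under all three involutions. -/
theorem exists_walk_eq (h : P.IsCommutingTriple φ ψ χ) (hc : P.IsConnected) (hf : P.LocallyFinite)
    (hp : IsAlternatingWalk φ ψ p) (v : P.Vert) : ∃ i s, twist χ s (p i) = v := by
  refine h.forall_mem hc hf (s := {v | ∃ i s, twist χ s (p i) = v}) (v₀ := p 0)
    ⟨0, false, rfl⟩ ?_ ?_ ?_ v
  · rintro _ ⟨i, s, rfl⟩
    exact ⟨_, s, by rw [← twist_comm h.comm₁, h.walk₁ hp]⟩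
  · rintro _ ⟨i, s, rfl⟩
    exact ⟨_, s, by rw [← twist_comm h.comm₂, h.walk₂ hp]⟩
  · rintro _ ⟨i, s, rfl⟩
    exact ⟨i, !s, by rw [h.twist_third]⟩

/-- A coincidence of two vertices of the walk at even distance is a translation symmetry. -/
theorem walk_translate (h : P.IsCommutingTriple φ ψ χ) (hp : IsAlternatingWalk φ ψ p) {i j : ℤ}
    {s : Bool} (hij : Even (i - j)) (e : p i = twist χ s (p j)) (x : ℤ) :
    p (x + (i - j)) = twist χ s (p x) := by
  -- The positions x and x + (i - j) have equal parity, so φ and ψ move both in the same direction.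
  have up : ∀ x, p (x + (i - j)) = twist χ s (p x) →
      p (x + 1 + (i - j)) = twist χ s (p (x + 1)) ∧
      p (x - 1 + (i - j)) = twist χ s (p (x - 1)) := fun x hx => by
    have a := congrArg φ hx
    have b := congrArg ψ hx
    rw [← twist_comm h.comm₁, h.walk₁ hp, h.walk₁ hp] at a
    rw [← twist_comm h.comm₂, h.walk₂ hp, h.walk₂ hp] at b
    have c : Even (x + (i - j)) ↔ Even x := by grind
    rw [show x + 1 + (i - j) = x + (i - j) + 1 by ring,
      show x - 1 + (i - j) = x + (i - j) - 1 by ring]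
    simp only [c] at a b
    split_ifs at a b
    · exact ⟨a, b⟩
    · exact ⟨b, a⟩
  induction x using Int.inductionOn' (b := j) with
  | zero => rw [← e]; congr 1; ring
  | succ k _ ih => exact (up k ih).1
  | pred k _ ih => exact (up k ih).2

/-- A coincidence of two vertices of the walk at odd distance is a reflection symmetry. -/
theorem walk_reflect (h : P.IsCommutingTriple φ ψ χ) (hp : IsAlternatingWalk φ ψ p) {i j : ℤ}
    {s : Bool} (hij : Odd (i - j)) (e : p i = twist χ s (p j)) (x : ℤ) :
    p (i + j - x) = twist χ s (p x) := by
  -- Here the two positions have opposite parity, so φ and ψ move them in opposite directions.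
  have up : ∀ x, p (i + j - x) = twist χ s (p x) →
      p (i + j - (x + 1)) = twist χ s (p (x + 1)) ∧
      p (i + j - (x - 1)) = twist χ s (p (x - 1)) := fun x hx => by
    have a := congrArg φ hx
    have b := congrArg ψ hx
    rw [← twist_comm h.comm₁, h.walk₁ hp, h.walk₁ hp] at a
    rw [← twist_comm h.comm₂, h.walk₂ hp, h.walk₂ hp] at b
    have c : Even (i + j - x) ↔ ¬ Even x := by grind
    rw [show i + j - (x + 1) = i + j - x - 1 by ring,
      show i + j - (x - 1) = i + j - x + 1 by ring]
    by_cases hx : Even x <;> simp only [c, hx, not_true, not_false_iff, if_true, if_false] at a b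
    · exact ⟨a, b⟩
    · exact ⟨b, a⟩
  induction x using Int.inductionOn' (b := j) with
  | zero => rw [← e]; congr 1; ring
  | succ k _ ih => exact (up k ih).1
  | pred k _ ih => exact (up k ih).2

/-- A permutation of the indices of the walk that exchanges the two types of steps and respects
coincidences induces a permutation of the vertices that exchanges the first two involutions. -/
theorem exists_swap (h : P.IsCommutingTriple φ ψ χ) (hc : P.IsConnected) (hf : P.LocallyFinite)
    (hp : IsAlternatingWalk φ ψ p) (θ : ℤ ≃ ℤ)
    (hθ : ∀ i j s, p i = twist χ s (p j) ↔ p (θ i) = twist χ s (p (θ j)))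
    (h₁ : ∀ i, θ (if Even i then i + 1 else i - 1) = if Even (θ i) then θ i - 1 else θ i + 1)
    (h₂ : ∀ i, θ (if Even i then i - 1 else i + 1) = if Even (θ i) then θ i + 1 else θ i - 1) :
    ∃ α : P.Vert ≃ P.Vert, (∀ v, α (φ v) = ψ (α v)) ∧ (∀ v, α (ψ v) = φ (α v)) ∧
      ∀ v, α (χ v) = χ (α v) := by
  choose ind sgn hrep using h.exists_walk_eq hc hf hp
  have cancel : ∀ i j s t, twist χ s (p i) = twist χ t (p j) ↔ p i = twist χ (s ^^ t) (p j) :=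
    fun i j s t => by
      rw [← (twist_injective h.invol₃ s).eq_iff, twist_twist h.invol₃, twist_twist h.invol₃]
      simp [twist]
  -- Since `θ` respects coincidences, the result does not depend on the chosen representation of
  -- `v`; this is `ha`.
  let a : P.Vert → P.Vert := fun v => twist χ (sgn v) (p (θ (ind v)))
  have ha : ∀ i s, a (twist χ s (p i)) = twist χ s (p (θ i)) := fun i s => by
    have := hrep (twist χ s (p i))
    rw [cancel, hθ, ← cancel] at this
    exact this
  have a_inj : Function.Injective a := fun v w hvw => by
    rw [← hrep v, ← hrep w, ha, ha, cancel, ← hθ, ← cancel, hrep, hrep] at hvw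
    exact hvw
  have a_surj : Function.Surjective a := fun w => by
    refine ⟨twist χ (sgn w) (p (θ.symm (ind w))), ?_⟩
    rw [ha, Equiv.apply_symm_apply, hrep]
  refine ⟨Equiv.ofBijective a (show Function.Bijective a from ⟨a_inj, a_surj⟩), fun v => ?_,
    fun v => ?_, fun v => ?_⟩ <;>
    simp only [Equiv.ofBijective_apply] <;> rw [← hrep v]
  · rw [← twist_comm h.comm₁, h.walk₁ hp, ha, ha, ← twist_comm h.comm₂, h.walk₂ hp, h₁]
  · rw [← twist_comm h.comm₂, h.walk₂ hp, ha, ha, ← twist_comm h.comm₁, h.walk₁ hp, h₂]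
  · rw [h.twist_third, ha, ha, h.twist_third]

/-- If vertices of the walk only coincide at even distances, the walk can be shifted. -/
theorem exists_swap_of_even (h : P.IsCommutingTriple φ ψ χ) (hc : P.IsConnected)
    (hf : P.LocallyFinite) (hp : IsAlternatingWalk φ ψ p)
    (hev : ∀ i j s, p i = twist χ s (p j) → Even (i - j)) :
    ∃ α : P.Vert ≃ P.Vert, (∀ v, α (φ v) = ψ (α v)) ∧ (∀ v, α (ψ v) = φ (α v)) ∧
      ∀ v, α (χ v) = χ (α v) := by
  refine h.exists_swap hc hf hp (Equiv.addRight 1) (fun i j s => ⟨fun e => ?_, fun e => ?_⟩)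
    (fun i => ?_) fun i => ?_
  · have := h.walk_translate hp (hev _ _ _ e) e (j + 1)
    rw [show j + 1 + (i - j) = i + 1 by ring] at this
    exact this
  · have := h.walk_translate hp (hev _ _ _ e) e j
    simp only [Equiv.coe_addRight] at this
    rw [show j + (i + 1 - (j + 1)) = i by ring] at this
    exact this
  · simp only [Equiv.coe_addRight]
    grind
  · simp only [Equiv.coe_addRight]
    grind

/-- A walk with two ends of the same kind and an odd number of vertices between them can be
reflected. -/
theorem exists_swap_of_odd (h : P.IsCommutingTriple φ ψ χ) (hc : P.IsConnected)
    (hf : P.LocallyFinite) (hp : IsAlternatingWalk φ ψ p) {m : ℤ} (hm : Odd m) {s : Bool}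
    (h₁ : ∀ x, p (-1 - x) = twist χ s (p x)) (h₂ : ∀ x, p (2 * m - 1 - x) = twist χ s (p x)) :
    ∃ α : P.Vert ≃ P.Vert, (∀ v, α (φ v) = ψ (α v)) ∧ (∀ v, α (ψ v) = φ (α v)) ∧
      ∀ v, α (χ v) = χ (α v) := by
  -- The map i ↦ m - 1 - i keeps parity, as m is odd, but reverses direction; so it exchanges
  -- φ-steps and ψ-steps. It remains to see that it respects coincidences.
  have key : ∀ i j u, p i = twist χ u (p j) → p (m - 1 - i) = twist χ u (p (m - 1 - j)) := by
    intro i j u e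
    by_cases hij : Even (i - j)
    · have e' : p j = twist χ u (p i) := by
        rw [e, twist_twist h.invol₃, Bool.xor_self]
        rfl
      have := h.walk_translate hp (by grind) e' (m - 1 - j)
      rw [show m - 1 - j + (j - i) = m - 1 - i by ring] at this
      exact this
    · have r := h.walk_reflect hp (Int.not_even_iff_odd.1 hij) e
      -- The end reflections carry the same twist, so their composite is an untwisted translation.
      have t : ∀ x, p (x + 2 * m) = p x := fun x => by
        have := h₂ (-1 - x)
        rw [h₁, twist_twist h.invol₃, Bool.xor_self] at this
        rw [show x + 2 * m = 2 * m - 1 - (-1 - x) by ring, this]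
        rfl
      have t' : ∀ x, p (x + (i + j + 1)) = twist χ (u ^^ s) (p x) := fun x => by
        rw [show x + (i + j + 1) = i + j - (-1 - x) by ring, r, h₁, twist_twist h.invol₃]
      -- The two positions differ by twice the translation of `t'`, whose twists cancel, modulo the
      -- period 2m.
      have t'' : p (m - 1 - j) = p (i + j - (m - 1 - i)) := by
        have := t' (m - 1 - j - 2 * m)
        rw [← t (m - 1 - j - 2 * m), show m - 1 - j - 2 * m + 2 * m = m - 1 - j by ring] at this
        have h3 := t' (m - 1 - j - 2 * m + (i + j + 1))
        rw [this, twist_twist h.invol₃, Bool.xor_self] at h3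
        rw [show i + j - (m - 1 - i) = m - 1 - j - 2 * m + (i + j + 1) + (i + j + 1) by ring, h3]
        rfl
      rw [t'', r, twist_twist h.invol₃, Bool.xor_self]
      rfl
  refine h.exists_swap hc hf hp (Equiv.subLeft (m - 1)) (fun i j s => ⟨key i j s, fun e => ?_⟩)
    (fun i => ?_) fun i => ?_
  · have := key _ _ _ e
    simpa using this
  · simp only [Equiv.subLeft_apply]
    grind
  · simp only [Equiv.subLeft_apply]
    grind

end IsCommutingTriple

/-! ### Neighbourhoods in barbed paths and ladders -/

theorem isomorphic_of_nbrs (hP : P.LocallyFinite) (hQ : Q.LocallyFinite) (lP : P.Loopless)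
    (lQ : Q.Loopless) (α : Q.Vert ≃ P.Vert)
    (h : ∀ v, P.nbrs Set.univ (α v) = (Q.nbrs Set.univ v).map α) : P.Isomorphic Q := by
  obtain ⟨f, -⟩ := exists_iso hQ hP lQ lP (S := Set.univ) (T := Set.univ) (by simp) (by simp) α h
    (fun v => by rw [Set.compl_univ, Set.compl_univ, nbrs_empty, nbrs_empty, Multiset.map_zero])
  exact Isomorphic.symm ⟨f⟩

theorem dartsAt_fin_three {V : Type*} (v : V) :
    {d : V × Fin 3 | d.1 = v} = {(v, 0), (v, 1), (v, 2)} := by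
  ext ⟨w, k⟩
  fin_cases k <;> simp [eq_comm]

theorem encard_fin_three {V : Type*} (v : V) : {d : V × Fin 3 | d.1 = v}.encard = 3 := by
  rw [dartsAt_fin_three, Set.encard_insert_of_notMem (by simp), Set.encard_pair (by simp)]
  rfl

section Barbed

variable {n : ℕ}

theorem barbedPath_isCubic : (barbedPath n).IsCubic := encard_fin_three

theorem barbedPath_target_zero (i : Fin n) : (barbedPath n).target (i, 0) = i := rfl

theorem barbedPath_target_one (i : Fin n) :
    (barbedPath n).target (i, 1) = if 0 < i.1 then ⟨i.1 - 1, by omega⟩ else i := by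
  simp only [target]
  split_ifs <;> rfl

theorem barbedPath_target_two (i : Fin n) :
    (barbedPath n).target (i, 2) = if h : i.1 + 1 < n then ⟨i.1 + 1, h⟩ else i := by
  simp only [target]
  split_ifs <;> rfl

theorem barbedPath_nbrs (i : Fin n) : (barbedPath n).nbrs Set.univ i =
    {(barbedPath n).target (i, 0), (barbedPath n).target (i, 1), (barbedPath n).target (i, 2)} := by
  refine nbrs_triple ?_ (by simp) (by simp) (by simp)
  rw [← dartsAt_fin_three i]
  simp [dartsAt]

theorem barbedPath_loopless : (barbedPath n).Loopless := by
  rintro ⟨i, k⟩ h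
  fin_cases k
  · rfl
  · have h' := (barbedPath_target_one i).symm.trans h
    change (if 0 < i.1 then ((⟨i.1 - 1, by omega⟩, 2) : Fin n × Fin 3) else (i, 1)) = (i, 1)
    split_ifs at h' ⊢ with hi
    · exact absurd (congrArg Fin.val h') (by simp; omega)
    · rfl
  · have h' := (barbedPath_target_two i).symm.trans h
    change (if h : i.1 + 1 < n then ((⟨i.1 + 1, h⟩, 1) : Fin n × Fin 3) else (i, 2)) = (i, 2)
    split_ifs at h' ⊢ with hi
    · exact absurd (congrArg Fin.val h') (by simp)
    · rfl

end Barbed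

section Ladder

variable {a b : Bool} {m : ℕ}

theorem ladder_isCubic : (ladder a b m).IsCubic := encard_fin_three

theorem ladder_target_zero (v : Fin m × Bool) : (ladder a b m).target (v, 0) = (v.1, !v.2) := rfl

theorem ladder_target_one (v : Fin m × Bool) : (ladder a b m).target (v, 1) =
    if 0 < v.1.1 then (⟨v.1.1 - 1, by omega⟩, v.2) else (v.1, a ^^ v.2) := by
  obtain ⟨i, s⟩ := v
  simp only [target]
  cases a <;> split_ifs <;> simp_all

theorem ladder_target_two (v : Fin m × Bool) : (ladder a b m).target (v, 2) =
    if h : v.1.1 + 1 < m then (⟨v.1.1 + 1, h⟩, v.2) else (v.1, b ^^ v.2) := by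
  obtain ⟨i, s⟩ := v
  simp only [target]
  cases b <;> split_ifs <;> simp_all

theorem ladder_nbrs (v : Fin m × Bool) : (ladder a b m).nbrs Set.univ v =
    {(ladder a b m).target (v, 0), (ladder a b m).target (v, 1), (ladder a b m).target (v, 2)} := by
  refine nbrs_triple ?_ (by simp) (by simp) (by simp)
  rw [← dartsAt_fin_three v]
  simp [dartsAt]

theorem ladder_loopless : (ladder a b m).Loopless := by
  rintro ⟨⟨i, s⟩, k⟩ h
  fin_cases k
  · simp [target] at h
  · have h' := (ladder_target_one (i, s)).symm.trans h
    split_ifs at h' with hi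
    · have := congrArg (fun v => v.1.1) h'
      simp at this hi
      omega
    · have := congrArg Prod.snd h'
      cases a <;> simp_all
  · have h' := (ladder_target_two (i, s)).symm.trans h
    split_ifs at h' with hi
    · have := congrArg (fun v => v.1.1) h'
      simp at this
    · have := congrArg Prod.snd h'
      cases b <;> simp_all

end Ladder

/-! ### Classification -/

namespace IsCommutingTriple

variable {φ ψ χ : P.Vert → P.Vert} {p : ℤ → P.Vert}

/-- The fixed points of χ are closed under all three involutions because these commute with χ, so by
connectedness they are nothing or everything. -/
theorem fixed_or_free (h : P.IsCommutingTriple φ ψ χ) (hc : P.IsConnected)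
    (hf : P.LocallyFinite) : (∀ v, χ v = v) ∨ ∀ v, χ v ≠ v := by
  by_cases hfix : ∃ v, χ v = v
  · obtain ⟨v₀, h₀⟩ := hfix
    refine Or.inl fun v => h.forall_mem hc hf (s := {v | χ v = v}) h₀ ?_ ?_ ?_ v
    · intro v hv
      rw [Set.mem_ofPred_eq, h.comm₁, hv]
    · intro v hv
      rw [Set.mem_ofPred_eq, h.comm₂, hv]
    · intro v hv
      rw [Set.mem_ofPred_eq, h.invol₃, hv]
  · exact Or.inr fun v hv => hfix ⟨v, hv⟩

/-- The second reflection symmetry of a finite alternating walk with an end. -/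
theorem exists_reflect [Finite P.Vert] (h : P.IsCommutingTriple φ ψ χ)
    (hp : IsAlternatingWalk φ ψ p) {s : Bool} (h₁ : ∀ x, p (-1 - x) = twist χ s (p x)) :
    ∃ m : ℕ, 0 < m ∧ ∃ r, ∀ x, p (2 * m - 1 - x) = twist χ r (p x) := by
  obtain ⟨i, j, hij, e⟩ : ∃ i j : ℕ, i < j ∧ p (2 * j) = p (2 * i) := by
    obtain ⟨i, j, hij, e⟩ := Finite.exists_ne_map_eq_of_infinite (fun i : ℕ => p (2 * i))
    rcases lt_or_gt_of_ne hij with hij | hij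
    · exact ⟨i, j, hij, e.symm⟩
    · exact ⟨j, i, hij, e⟩
  -- The repetition of an even position is an untwisted translation by 2(j - i); composed with the
  -- first reflection it gives the second.
  refine ⟨j - i, by omega, s, fun x => ?_⟩
  have t := h.walk_translate hp (i := 2 * j) (j := 2 * i) (s := false) (by grind) e (-1 - x)
  rw [h₁] at t
  rw [← show twist χ false (twist χ s (p x)) = twist χ s (p x) from rfl, ← t]
  congr 1
  push_cast [hij.le]
  ring

/-- The vertices between two consecutive ends of an alternating walk. -/
theorem walk_inj (h : P.IsCommutingTriple φ ψ χ) (hp : IsAlternatingWalk φ ψ p) {s : Bool}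
    (h₁ : ∀ x, p (-1 - x) = twist χ s (p x)) {m : ℕ}
    (hmin : ∀ k : ℕ, 0 < k → (∃ r, ∀ x, p (2 * k - 1 - x) = twist χ r (p x)) → m ≤ k)
    {i j : ℕ} (hi : i < m) (hj : j < m) {u : Bool} (e : p i = twist χ u (p j)) : i = j := by
  -- A coincidence inside the segment would produce a reflection at a smaller `k`: directly at odd
  -- distance, after composition with the first reflection at even distance.
  have key : ∀ {i j : ℕ} {u : Bool}, i < j → j < m → p j ≠ twist χ u (p i) := by
    intro i j u hij hj e
    rcases Nat.even_or_odd (j - i) with hev | hodd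
    · have t := h.walk_translate hp (i := j) (j := i) (by grind) e
      have := hmin ((j - i) / 2) (by grind) ⟨u ^^ s, fun x => by
        have := t (-1 - x)
        rw [h₁, twist_twist h.invol₃] at this
        rw [← this]
        congr 1
        grind⟩
      omega
    · have t := h.walk_reflect hp (i := j) (j := i) (by grind) e
      have := hmin ((i + j + 1) / 2) (by grind) ⟨u, fun x => by
        rw [← t]
        congr 1
        grind⟩
      grind
  rcases lt_trichotomy i j with hij | hij | hij
  · refine absurd ?_ (key (u := u) hij hj)
    rw [e, twist_twist h.invol₃, Bool.xor_self]
    rfl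
  · exact hij
  · exact absurd e (key hij hi)

/-- Stepping out of the segment at either end leads back to the end vertex or its χ-image, so the
segment and its χ-image are closed under the involutions. -/
theorem walk_surj (h : P.IsCommutingTriple φ ψ χ) (hc : P.IsConnected)
    (hf : P.LocallyFinite) (hp : IsAlternatingWalk φ ψ p) {s r : Bool} {m : ℕ} (hm : 0 < m)
    (h₁ : p (-1) = twist χ s (p 0)) (h₂ : p m = twist χ r (p (m - 1)))
    (v : P.Vert) : ∃ i : ℕ, i < m ∧ ∃ u, twist χ u (p i) = v := by
  have step : ∀ i : ℕ, i < m → ∀ u, (∃ k : ℕ, k < m ∧ ∃ t, twist χ t (p k) = twist χ u (p (i - 1)))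
      ∧ ∃ k : ℕ, k < m ∧ ∃ t, twist χ t (p k) = twist χ u (p (i + 1)) := by
    intro i hi u
    constructor
    · rcases Nat.eq_zero_or_pos i with rfl | hpos
      · refine ⟨0, hm, u ^^ s, ?_⟩
        rw [← twist_twist h.invol₃, Nat.cast_zero, ← h₁, zero_sub]
      · exact ⟨i - 1, by omega, u, by push_cast [hpos]; rfl⟩
    · rcases lt_or_eq_of_le (Nat.succ_le_of_lt hi) with hlt | heq
      · exact ⟨i + 1, hlt, u, by push_cast; rfl⟩
      · refine ⟨i, hi, u ^^ r, ?_⟩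
        have e1 : (i : ℤ) + 1 = m := by exact_mod_cast heq
        have e2 : (i : ℤ) = m - 1 := by omega
        rw [← twist_twist h.invol₃, e1, h₂, e2]
  refine h.forall_mem hc hf (s := {v | ∃ i : ℕ, i < m ∧ ∃ u, twist χ u (p i) = v}) (v₀ := p 0)
    ⟨0, hm, false, rfl⟩ ?_ ?_ ?_ v
  · rintro _ ⟨i, hi, s, rfl⟩
    rw [Set.mem_ofPred_eq, ← twist_comm h.comm₁, h.walk₁ hp]
    split_ifs
    · exact (step i hi s).2
    · exact (step i hi s).1
  · rintro _ ⟨i, hi, s, rfl⟩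
    rw [Set.mem_ofPred_eq, ← twist_comm h.comm₂, h.walk₂ hp]
    split_ifs
    · exact (step i hi s).1
    · exact (step i hi s).2
  · rintro _ ⟨i, hi, s, rfl⟩
    exact ⟨i, hi, !s, by rw [h.twist_third]⟩

/-- The identity χ contributes a semi-edge at every vertex, and the steps that stall at the ends are
the second semi-edges there. -/
theorem isomorphic_barbedPath (h : P.IsCommutingTriple φ ψ χ) (hf : P.LocallyFinite)
    (lP : P.Loopless) (hp : IsAlternatingWalk φ ψ p) {m : ℕ} (hfix : ∀ v, χ v = v)
    (h₁ : p (-1) = p 0) (h₂ : p m = p (m - 1))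
    (hinj : ∀ i j : ℕ, i < m → j < m → p i = p j → i = j)
    (hsurj : ∀ v, ∃ i : ℕ, i < m ∧ p i = v) : P.Isomorphic (barbedPath m) := by
  let α : Fin m ≃ P.Vert := Equiv.ofBijective (fun i => p i)
    ⟨fun i j hij => Fin.ext (hinj _ _ i.2 j.2 hij), fun v => by
      obtain ⟨i, hi, e⟩ := hsurj v
      exact ⟨⟨i, hi⟩, e⟩⟩
  have hα : ∀ i, α i = p i := fun i => rfl
  refine isomorphic_of_nbrs hf barbedPath_isCubic.locallyFinite lP barbedPath_loopless α fun i => ?_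
  have := h.nbrs_walk hp false i
  have e : ∀ s v, twist χ s v = v := fun s v => by cases s <;> simp [twist, hfix]
  simp only [e] at this
  rw [hα, this, barbedPath_nbrs, barbedPath_target_zero, barbedPath_target_one,
    barbedPath_target_two]
  simp only [Multiset.insert_eq_cons, Multiset.map_cons, Multiset.map_singleton, hα]
  congr 2
  · split_ifs with hi
    · congr 1
      push_cast [hi]
      rfl
    · have : i.1 = 0 := by omega
      simp [this, h₁]
  · congr 1
    split_ifs with hi
    · congr 1
    · have e1 : (i.1 : ℤ) + 1 = m := by omega
      have e2 : (i : ℤ) = m - 1 := by omega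
      rw [e1, h₂, e2]

/-- The walk and its χ-image are the two rails and χ the rungs. The step at an end returns to its
vertex (open) or runs parallel to the rung (closed), according to the twist. -/
theorem isomorphic_ladder (h : P.IsCommutingTriple φ ψ χ) (hf : P.LocallyFinite)
    (lP : P.Loopless) (hp : IsAlternatingWalk φ ψ p) {m : ℕ} {s r : Bool} (hfree : ∀ v, χ v ≠ v)
    (h₁ : p (-1) = twist χ s (p 0)) (h₂ : p m = twist χ r (p (m - 1)))
    (hinj : ∀ (i j : ℕ) (u : Bool), i < m → j < m → p i = twist χ u (p j) → i = j)
    (hsurj : ∀ v, ∃ i : ℕ, i < m ∧ ∃ u, twist χ u (p i) = v) : P.Isomorphic (ladder s r m) := by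
  let α : Fin m × Bool ≃ P.Vert := Equiv.ofBijective (fun i => twist χ i.2 (p i.1))
    ⟨fun ⟨i, u⟩ ⟨j, t⟩ hij => by
      have e : p i = twist χ (u ^^ t) (p j) := by
        have hij' : twist χ u (p i) = twist χ t (p j) := hij
        rw [← twist_twist h.invol₃, ← hij', twist_twist h.invol₃, Bool.xor_self]
        rfl
      have e' : i = j := Fin.ext (hinj _ _ _ i.2 j.2 e)
      subst e'
      cases u <;> cases t
      · rfl
      · exact absurd (Eq.symm hij) (hfree _)
      · exact absurd hij (hfree _)
      · rfl, fun v => by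
      obtain ⟨i, hi, u, e⟩ := hsurj v
      exact ⟨(⟨i, hi⟩, u), e⟩⟩
  have hα : ∀ i, α i = twist χ i.2 (p i.1) := fun i => rfl
  refine isomorphic_of_nbrs hf ladder_isCubic.locallyFinite lP ladder_loopless α ?_
  rintro ⟨i, u⟩
  rw [hα, h.nbrs_walk hp, ladder_nbrs, ladder_target_zero, ladder_target_one, ladder_target_two]
  simp only [Multiset.insert_eq_cons, Multiset.map_cons, Multiset.map_singleton, hα]
  congr 2
  · split_ifs with hi
    · push_cast [hi]
      rfl
    · have : i.1 = 0 := by omega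
      rw [Bool.xor_comm, ← twist_twist h.invol₃]
      simp [this, h₁]
  · congr 1
    split_ifs with hi
    · simp
    · have e1 : (i.1 : ℤ) + 1 = m := by omega
      have e2 : (i : ℤ) = m - 1 := by omega
      rw [Bool.xor_comm, ← twist_twist h.invol₃, e1, h₂, e2]

/-- The finite cubic pregraphs with three such involutions, unless the first two are exchanged by
an automorphism. -/
theorem classification_of_end [Finite P.Vert] (h : P.IsCommutingTriple φ ψ χ) (hc : P.IsConnected)
    (hf : P.LocallyFinite) (lP : P.Loopless) (hp : IsAlternatingWalk φ ψ p) {s : Bool}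
    (h₁ : ∀ x, p (-1 - x) = twist χ s (p x)) :
    (∃ α : P.Vert ≃ P.Vert, (∀ v, α (φ v) = ψ (α v)) ∧ (∀ v, α (ψ v) = φ (α v)) ∧
      ∀ v, α (χ v) = χ (α v)) ∨
    (∃ m, Even m ∧ P.Isomorphic (barbedPath m)) ∨
    ∃ m a b, (Even m ∨ a ≠ b) ∧ P.Isomorphic (ladder a b m) := by
  classical
  -- The least `m` is taken, so that the segment from 0 to m - 1 has no repetitions.
  have hex := h.exists_reflect hp h₁
  obtain ⟨hm, r, h₂⟩ := Nat.find_spec hex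
  have hmin : ∀ k : ℕ, 0 < k → (∃ r, ∀ x, p (2 * k - 1 - x) = twist χ r (p x)) →
    Nat.find hex ≤ k := fun k h3 h4 => Nat.find_le ⟨h3, h4⟩
  generalize Nat.find hex = m at *
  have h₁' : p (-1) = twist χ s (p 0) := by
    rw [← h₁]
    simp
  have h₂' : p m = twist χ r (p (m - 1)) := by
    rw [← h₂]
    congr 1
    ring
  have inj := fun (i j : ℕ) (u : Bool) (hi : i < m) (hj : j < m) (e : p i = twist χ u (p j)) =>
    h.walk_inj hp h₁ hmin hi hj e
  have surj := h.walk_surj hc hf hp hm h₁' h₂'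
  rcases h.fixed_or_free hc hf with hfix | hfree
  · have e : ∀ s v, twist χ s v = v := fun s v => by cases s <;> simp [twist, hfix]
    rcases Nat.even_or_odd m with hev | hodd
    · refine Or.inr (Or.inl ⟨m, hev, h.isomorphic_barbedPath hf lP hp hfix ?_ ?_ ?_ ?_⟩)
      · rw [h₁', e]
      · rw [h₂', e]
      · exact fun i j hi hj hij => inj i j false hi hj hij
      · intro v
        obtain ⟨i, hi, u, hu⟩ := surj v
        exact ⟨i, hi, by rw [← hu, e]⟩
    · refine Or.inl (h.exists_swap_of_odd hc hf hp (m := m) (by exact_mod_cast hodd) h₁ ?_)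
      intro x
      rw [h₂, e, e]
  · by_cases hcase : Even m ∨ s ≠ r
    · exact Or.inr (Or.inr ⟨m, s, r, hcase, h.isomorphic_ladder hf lP hp hfree h₁' h₂' inj surj⟩)
    · push Not at hcase
      obtain ⟨hodd, rfl⟩ := hcase
      rw [Nat.not_even_iff_odd] at hodd
      exact Or.inl (h.exists_swap_of_odd hc hf hp (m := m) (by exact_mod_cast hodd) h₁ h₂)

theorem classification [Finite P.Vert] (h : P.IsCommutingTriple φ ψ χ) (hc : P.IsConnected)
    (hf : P.LocallyFinite) (lP : P.Loopless) :
    (∃ α : P.Vert ≃ P.Vert, (∀ v, α (φ v) = ψ (α v)) ∧ (∀ v, α (ψ v) = φ (α v)) ∧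
      ∀ v, α (χ v) = χ (α v)) ∨
    (∃ m, Even m ∧ P.Isomorphic (barbedPath m)) ∨
    ∃ m a b, (Even m ∨ a ≠ b) ∧ P.Isomorphic (ladder a b m) := by
  obtain ⟨v₀⟩ := hc.1
  obtain ⟨p, -, hp⟩ := exists_isAlternatingWalk h.invol₁ h.invol₂ v₀
  by_cases hev : ∀ i j s, p i = twist χ s (p j) → Even (i - j)
  · exact Or.inl (h.exists_swap_of_even hc hf hp hev)
  push Not at hev
  obtain ⟨i, j, s, e, hij⟩ := hev
  rw [Int.not_even_iff_odd] at hij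
  have t := h.walk_reflect hp hij e
  -- The axis lies between the positions k - 1 and k; shifting by k puts it between -1 and 0, and
  -- for odd k exchanges the roles of φ and ψ.
  obtain ⟨k, hk⟩ : ∃ k, i + j = 2 * k - 1 := ⟨(i + j + 1) / 2, by grind⟩
  have t' : ∀ x, (fun x => p (x + k)) (-1 - x) = twist χ s ((fun x => p (x + k)) x) := fun x => by
    simp only
    rw [← t]
    congr 1
    grind
  rcases Int.even_or_odd k with hk' | hk'
  · exact h.classification_of_end hc hf lP (hp.shift_even hk') t'
  · rcases h.swap.classification_of_end hc hf lP (hp.shift_odd hk') t' with ⟨α, h1, h2, h3⟩ | h'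
    · exact Or.inl ⟨α, h2, h1, h3⟩
    · exact Or.inr h'

end IsCommutingTriple

/-! ### Two factors in barbed paths and ladders -/

/-- The 2-factor whose complement consists of the given darts, one at each vertex. -/
def TwoFactor.ofOmit (hP : P.IsCubic) (o : P.Vert → P.Dart) (ho : ∀ v, P.origin (o v) = v)
    (hr : ∀ v, P.rev (o v) = o (P.target (o v))) : P.TwoFactor where
  darts := {d | d ≠ o (P.origin d)}
  rev_mem d hd h := hd (by
    have h1 := congrArg P.rev h
    rw [P.rev_rev, hr, ← h, target_rev] at h1
    exact h1)
  degree_eq v := by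
    have h1 : {d | d ∈ {d | d ≠ o (P.origin d)} ∧ P.origin d = v} =
        {d | P.origin d = v} \ {o v} := by
      ext d
      simp only [Set.mem_ofPred_eq, Set.mem_sdiff, Set.mem_singleton_iff]
      constructor
      · rintro ⟨h1, rfl⟩
        exact ⟨rfl, h1⟩
      · rintro ⟨rfl, h1⟩
        exact ⟨h1, rfl⟩
    rw [h1]
    have h2 := Set.encard_sdiff_singleton_add_one (s := {d | P.origin d = v}) (a := o v) (ho v)
    rw [hP v, show (3 : ℕ∞) = 2 + 1 from rfl] at h2
    exact (ENat.add_left_injective_of_ne_top (by simp)) h2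

/-- The orbit v, χ v, ρ v, χ (ρ v) of two commuting involutions is a possibly degenerate square. -/
theorem isSquareAt_of_commute {S : Set P.Dart} {χ ρ : P.Vert → P.Vert} (hχ : ∀ v, χ (χ v) = v)
    (hρ : ∀ v, ρ (ρ v) = v) (hc : ∀ v, χ (ρ v) = ρ (χ v)) (h : ∀ v, P.nbrs S v = {χ v, ρ v})
    (v : P.Vert) : P.IsSquareAt S v :=
  ⟨χ v, ρ v, χ (ρ v), h v, by rw [h, hχ, hc], by rw [h, hρ, Multiset.pair_comm],
    by rw [h, hχ, ← hc, hρ, Multiset.pair_comm]⟩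

/-- The dart omitted at level `i`, depending on parity. -/
def omitIndex (e i : ℕ) : Fin 3 := if Even (i + e) then 1 else 2

/-- This treats barbed paths and ladders together: dart 0 is always kept, and of darts 1 and 2 the
one omitted for parity `e` is the one kept for parity `e + 1`. -/
theorem ofOmit_nbrs_fin {V : Type} {rev : V × Fin 3 → V × Fin 3} (hrev : ∀ d, rev (rev d) = d)
    (hP : (Pregraph.mk V (V × Fin 3) Prod.fst rev hrev).IsCubic) (l : V → ℕ) (e : ℕ)
    (hr : ∀ v, rev (v, omitIndex e (l v)) =
      ((rev (v, omitIndex e (l v))).1, omitIndex e (l (rev (v, omitIndex e (l v))).1))) (v : V) :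
    (Pregraph.mk V (V × Fin 3) Prod.fst rev hrev).nbrs
      (TwoFactor.ofOmit hP (fun v => (v, omitIndex e (l v))) (fun _ => rfl) hr).darts v =
      {(rev (v, 0)).1, (rev (v, omitIndex (e + 1) (l v))).1} := by
  refine nbrs_pair (P := Pregraph.mk V (V × Fin 3) Prod.fst rev hrev) ?_ ?_
  · ext ⟨w, k⟩
    simp only [dartsAt, TwoFactor.ofOmit, omitIndex, Set.mem_ofPred_eq, Set.mem_insert_iff,
      Set.mem_singleton_iff, Prod.mk.injEq, ne_eq]
    have : Even (l v + (e + 1)) ↔ ¬ Even (l v + e) := by grind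
    fin_cases k <;> by_cases h : w = v <;> by_cases hev : Even (l v + e) <;> simp [h, hev, this]
  · simp only [omitIndex]
    split_ifs <;> simp

theorem Reachable.symm {v w : P.Vert} (h : P.Reachable v w) : P.Reachable w v := by
  induction h with
  | refl => exact .refl
  | tail _ h ih =>
    obtain ⟨d, rfl, rfl⟩ := h
    exact .head ⟨P.rev d, rfl, by rw [P.rev_rev]⟩ ih

theorem isConnected_of_reachable (v₀ : P.Vert) (h : ∀ v, P.Reachable v₀ v) : P.IsConnected :=
  ⟨⟨v₀⟩, fun v w => (h v).symm.trans (h w)⟩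

section Barbed

variable {n : ℕ}

theorem barbedPath_isConnected (hn : 0 < n) : (barbedPath n).IsConnected := by
  refine isConnected_of_reachable (P := barbedPath n) ⟨0, hn⟩ ?_
  rintro ⟨i, hi⟩
  induction i with
  | zero => exact .refl
  | succ i ih =>
    refine .tail (ih (by omega)) ⟨(⟨i, by omega⟩, 2), rfl, ?_⟩
    exact (barbedPath_target_two _).trans (dif_pos hi)

/-- An edge between consecutive levels is dart 2 below and dart 1 above, and the omitted index
alternates with the level; so an edge is omitted at both of its ends or at neither. -/
theorem barbedPath_rev_omit (e : ℕ) (i : Fin n) :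
    (barbedPath n).rev (i, omitIndex e i) = ((barbedPath n).target (i, omitIndex e i),
      omitIndex e ((barbedPath n).target (i, omitIndex e i)).1) := by
  by_cases h : Even (i.1 + e)
  · have h1 : omitIndex e i = 1 := if_pos h
    rw [h1, barbedPath_target_one]
    change (if 0 < i.1 then ((⟨i.1 - 1, by omega⟩, 2) : Fin n × Fin 3) else (i, 1)) = _
    split_ifs with hi
    · have : ¬ Even (i.1 - 1 + e) := by grind
      simp [omitIndex, this]
    · rw [h1]
  · have h1 : omitIndex e i = 2 := if_neg h
    rw [h1, barbedPath_target_two]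
    change (if h : i.1 + 1 < n then ((⟨i.1 + 1, h⟩, 1) : Fin n × Fin 3) else (i, 2)) = _
    split_ifs with hi
    · have : Even (i.1 + 1 + e) := by grind
      simp [omitIndex, this]
    · rw [h1]

/-- The factor of the barbed path that pairs consecutive vertices, from parity `e` on. -/
def barbedPathFactor (n e : ℕ) : (barbedPath n).TwoFactor :=
  TwoFactor.ofOmit barbedPath_isCubic (fun i => (i, omitIndex e i)) (fun _ => rfl)
    (barbedPath_rev_omit e)

theorem barbedPathFactor_nbrs (e : ℕ) (i : Fin n) :
    (barbedPath n).nbrs (barbedPathFactor n e).darts i =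
      {i, (barbedPath n).target (i, omitIndex (e + 1) i)} :=
  ofOmit_nbrs_fin (barbedPath n).rev_rev barbedPath_isCubic (fun i => i.1) e
    (barbedPath_rev_omit e) i

theorem barbedPathFactor_isC4QuotientFactor (e : ℕ) :
    (barbedPathFactor n e).IsC4QuotientFactor := by
  refine TwoFactor.isC4QuotientFactor_of_isSquareAt barbedPath_isCubic.locallyFinite
    barbedPath_loopless _ fun i => ?_
  refine isSquareAt_of_commute (P := barbedPath n) (χ := fun i => i)
    (ρ := fun i => (barbedPath n).target (i, omitIndex (e + 1) i)) (fun _ => rfl) (fun i => ?_)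
    (fun _ => rfl) (barbedPathFactor_nbrs e) i
  simp only
  rw [← barbedPath_rev_omit, target_rev]

end Barbed

section Ladder

variable {a b : Bool} {m : ℕ}

theorem ladder_isConnected (hm : 0 < m) : (ladder a b m).IsConnected := by
  refine isConnected_of_reachable (P := ladder a b m) (⟨0, hm⟩, false) ?_
  rintro ⟨⟨i, hi⟩, s⟩
  have h : (ladder a b m).Reachable (⟨0, hm⟩, false) (⟨i, hi⟩, false) := by
    induction i with
    | zero => exact .refl
    | succ i ih =>
      refine .tail (ih (by omega)) ⟨((⟨i, by omega⟩, false), 2), rfl, ?_⟩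
      exact (ladder_target_two _).trans (dif_pos hi)
  cases s
  · exact h
  · exact .tail h ⟨((⟨i, hi⟩, false), 0), rfl, rfl⟩

theorem ladder_rev_omit (e : ℕ) (v : Fin m × Bool) :
    (ladder a b m).rev (v, omitIndex e v.1) = ((ladder a b m).target (v, omitIndex e v.1),
      omitIndex e ((ladder a b m).target (v, omitIndex e v.1)).1.1) := by
  obtain ⟨i, s⟩ := v
  by_cases h : Even (i.1 + e)
  · have h1 : omitIndex e i = 1 := if_pos h
    simp only [h1]
    rw [ladder_target_one]
    change (if 0 < i.1 then (((⟨i.1 - 1, by omega⟩, s), 2) : (Fin m × Bool) × Fin 3)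
      else if a then ((i, !s), 1) else ((i, s), 1)) = _
    split_ifs with hi
    · have : ¬ Even (i.1 - 1 + e) := by grind
      simp [omitIndex, this]
    · simp_all
    · simp_all
  · have h1 : omitIndex e i = 2 := if_neg h
    simp only [h1]
    rw [ladder_target_two]
    change (if h : i.1 + 1 < m then (((⟨i.1 + 1, h⟩, s), 1) : (Fin m × Bool) × Fin 3)
      else if b then ((i, !s), 2) else ((i, s), 2)) = _
    split_ifs with hi
    · have : Even (i.1 + 1 + e) := by grind
      simp [omitIndex, this]
    · simp_all
    · simp_all

/-- The factor of the ladder that pairs consecutive rungs, from parity `e` on. -/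
def ladderFactor (a b : Bool) (m e : ℕ) : (ladder a b m).TwoFactor :=
  TwoFactor.ofOmit ladder_isCubic (fun v => (v, omitIndex e v.1)) (fun _ => rfl)
    (ladder_rev_omit e)

theorem ladderFactor_nbrs (e : ℕ) (v : Fin m × Bool) :
    (ladder a b m).nbrs (ladderFactor a b m e).darts v =
      {(v.1, !v.2), (ladder a b m).target (v, omitIndex (e + 1) v.1)} :=
  ofOmit_nbrs_fin (ladder a b m).rev_rev ladder_isCubic (fun v => v.1.1) e
    (ladder_rev_omit e) v

theorem ladderFactor_isC4QuotientFactor (e : ℕ) :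
    (ladderFactor a b m e).IsC4QuotientFactor := by
  refine TwoFactor.isC4QuotientFactor_of_isSquareAt ladder_isCubic.locallyFinite
    ladder_loopless _ fun i => ?_
  refine isSquareAt_of_commute (P := ladder a b m) (χ := fun v => (v.1, !v.2))
    (ρ := fun v => (ladder a b m).target (v, omitIndex (e + 1) v.1)) (fun _ => by simp)
    (fun v => ?_) (fun v => ?_) (ladderFactor_nbrs e) i
  · simp only
    rw [← ladder_rev_omit, target_rev]
  · simp only [omitIndex]
    split_ifs
    · rw [ladder_target_one, ladder_target_one]
      simp only
      split_ifs <;> simp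
    · rw [ladder_target_two, ladder_target_two]
      simp only
      split_ifs <;> simp

end Ladder

/-! ### The two factors are not isomorphic -/

theorem TwoFactor.Isomorphic.exists_equiv {F G : P.TwoFactor} (h : F.Isomorphic G) :
    ∃ α : P.Vert ≃ P.Vert, ∀ v, P.nbrs G.darts (α v) = (P.nbrs F.darts v).map α := by
  obtain ⟨f, hf⟩ := h
  exact ⟨f.vert, fun v => by rw [← hf, f.nbrs_image]⟩

theorem Isomorphic.exists_equiv (h : P.Isomorphic Q) :
    ∃ α : P.Vert ≃ Q.Vert, ∀ v, Q.nbrs Set.univ (α v) = (P.nbrs Set.univ v).map α := by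
  obtain ⟨f⟩ := h
  exact ⟨f.vert, fun v => by rw [← f.nbrs_image, Set.image_univ, f.dart.range_eq_univ]⟩

/-- For parity 1, vertex 0 keeps both of its semi-edges and is a component by itself; for parity 0
and even `n`, every vertex keeps an edge to another vertex. -/
theorem barbedPath_hasMultiple {n : ℕ} (hn : 0 < n) (hev : Even n) :
    (barbedPath n).HasMultipleC4QuotientFactors := by
  refine ⟨barbedPathFactor n 1, barbedPathFactor n 0, barbedPathFactor_isC4QuotientFactor 1,
    barbedPathFactor_isC4QuotientFactor 0, fun h => ?_⟩
  obtain ⟨α, hα⟩ := h.exists_equiv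
  have h0 := hα ⟨0, hn⟩
  have e0 : omitIndex (1 + 1) 0 = 1 := rfl
  rw [barbedPathFactor_nbrs, barbedPathFactor_nbrs, e0, barbedPath_target_one,
    if_neg (by simp)] at h0
  simp only [Multiset.insert_eq_cons, Multiset.map_cons, Multiset.map_singleton] at h0
  generalize α ⟨0, hn⟩ = i at h0
  have h1 : (barbedPath n).target (i, omitIndex (0 + 1) i) = i := by simpa using h0
  by_cases hi : Even (i.1 + 1)
  · rw [show omitIndex (0 + 1) i = 1 from if_pos hi, barbedPath_target_one, if_pos (by grind)] at h1
    have := congrArg Fin.val h1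
    simp only at this
    grind
  · rw [show omitIndex (0 + 1) i = 2 from if_neg hi, barbedPath_target_two, dif_pos (by grind)] at h1
    have := congrArg Fin.val h1
    simp only at this
    grind

/-- For parity 1, the rung at level 0 and its parallel edge form a component; for parity 0 and even
`m`, neither closing edge is kept. -/
theorem doubleClosedLadder_hasMultiple {m : ℕ} (hm : 0 < m) (hev : Even m) :
    (doubleClosedLadder m).HasMultipleC4QuotientFactors := by
  refine ⟨ladderFactor true true m 1, ladderFactor true true m 0,
    ladderFactor_isC4QuotientFactor 1, ladderFactor_isC4QuotientFactor 0, fun h => ?_⟩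
  obtain ⟨α, hα⟩ := h.exists_equiv
  have h0 := hα (⟨0, hm⟩, false)
  have e0 : omitIndex (1 + 1) 0 = 1 := rfl
  rw [ladderFactor_nbrs, ladderFactor_nbrs] at h0
  simp only [e0] at h0
  rw [ladder_target_one, if_neg (by simp)] at h0
  simp only [Multiset.insert_eq_cons, Multiset.map_cons, Multiset.map_singleton, Bool.xor_false,
    Bool.not_false] at h0
  generalize α (⟨0, hm⟩, false) = v at h0
  generalize α (⟨0, hm⟩, true) = w at h0
  have h1 : (ladder true true m).target (v, omitIndex (0 + 1) v.1) = (v.1, !v.2) := by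
    rcases pair_eq_cases h0 with h | h <;> rw [h.1, h.2]
  by_cases hi : Even (v.1.1 + 1)
  · rw [show omitIndex (0 + 1) v.1 = 1 from if_pos hi, ladder_target_one, if_pos (by grind)] at h1
    exact absurd (congrArg Prod.snd h1) (by simp)
  · rw [show omitIndex (0 + 1) v.1 = 2 from if_neg hi, ladder_target_two,
      dif_pos (by grind)] at h1
    exact absurd (congrArg Prod.snd h1) (by simp)

/-- For parity 1, the semi-edges at level 0 are kept. For parity 0 no semi-edge is kept: the far end
edges are omitted if `m` is even and are not semi-edges if that end is closed. -/
theorem ladder_hasMultiple_of_open {m : ℕ} {b : Bool} (hm : 0 < m) (hev : Even m ∨ b = true) :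
    (ladder false b m).HasMultipleC4QuotientFactors := by
  refine ⟨ladderFactor false b m 1, ladderFactor false b m 0,
    ladderFactor_isC4QuotientFactor 1, ladderFactor_isC4QuotientFactor 0, fun h => ?_⟩
  obtain ⟨α, hα⟩ := h.exists_equiv
  have h0 := hα (⟨0, hm⟩, false)
  have e0 : omitIndex (1 + 1) 0 = 1 := rfl
  rw [ladderFactor_nbrs, ladderFactor_nbrs] at h0
  simp only [e0] at h0
  rw [ladder_target_one, if_neg (by simp)] at h0
  simp only [Multiset.insert_eq_cons, Multiset.map_cons, Multiset.map_singleton, Bool.xor_false,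
    Bool.not_false] at h0
  generalize α (⟨0, hm⟩, false) = v at h0
  generalize α (⟨0, hm⟩, true) = w at h0
  have h1 : (ladder false b m).target (v, omitIndex (0 + 1) v.1) = v := by
    rcases pair_eq_cases h0 with h | h
    · exact h.2
    · exact absurd (congrArg Prod.snd h.1) (by simp)
  by_cases hi : Even (v.1.1 + 1)
  · rw [show omitIndex (0 + 1) v.1 = 1 from if_pos hi, ladder_target_one, if_pos (by grind)] at h1
    have := congrArg (fun v => v.1.1) h1
    simp only at this
    grind
  · rw [show omitIndex (0 + 1) v.1 = 2 from if_neg hi, ladder_target_two] at h1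
    split_ifs at h1 with hlt
    · have := congrArg (fun v => v.1.1) h1
      simp only at this
      grind
    · have hb : b = true := by
        rcases hev with hev | hev
        · grind
        · exact hev
      subst hb
      exact absurd (congrArg Prod.snd h1) (by simp)

theorem ladder_flip (a b : Bool) (m : ℕ) : (ladder a b m).Isomorphic (ladder b a m) := by
  refine isomorphic_of_nbrs ladder_isCubic.locallyFinite ladder_isCubic.locallyFinite
    ladder_loopless ladder_loopless (Equiv.prodCongr Fin.revPerm (Equiv.refl Bool)) ?_
  rintro ⟨i, s⟩
  have e1 : (ladder a b m).target ((i.rev, s), 1) =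
      Equiv.prodCongr Fin.revPerm (Equiv.refl Bool) ((ladder b a m).target ((i, s), 2)) := by
    rw [ladder_target_one, ladder_target_two]
    simp only [Fin.val_rev]
    split_ifs
    · simp [Fin.ext_iff]
      omega
    · omega
    · omega
    · simp
  have e2 : (ladder a b m).target ((i.rev, s), 2) =
      Equiv.prodCongr Fin.revPerm (Equiv.refl Bool) ((ladder b a m).target ((i, s), 1)) := by
    rw [ladder_target_one, ladder_target_two]
    simp only [Fin.val_rev]
    split_ifs
    · simp [Fin.ext_iff]
      omega
    · omega
    · omega
    · simp
  have e3 := ladder_nbrs (a := a) (b := b) (i.rev, s)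
  rw [e1, e2, ladder_target_zero] at e3
  refine e3.trans ?_
  rw [ladder_nbrs, ladder_target_zero]
  simp only [Multiset.insert_eq_cons, Multiset.map_cons,
    ← Multiset.cons_zero]
  rw [Multiset.cons_swap (Equiv.prodCongr Fin.revPerm (Equiv.refl Bool) _)
    (Equiv.prodCongr Fin.revPerm (Equiv.refl Bool) ((ladder b a m).target ((i, s), 2)))]
  rfl

/-! ### Invariants -/

/-- Some vertex is incident to a semi-edge or a loop. -/
theorem Isomorphic.exists_mem (h : P.Isomorphic Q) (hP : ∃ v, v ∈ P.nbrs Set.univ v) :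
    ∃ v, v ∈ Q.nbrs Set.univ v := by
  obtain ⟨α, hα⟩ := h.exists_equiv
  obtain ⟨v, hv⟩ := hP
  exact ⟨α v, by rw [hα]; exact Multiset.mem_map_of_mem _ hv⟩

/-- This invariant separates barbed paths from ladders. -/
theorem Isomorphic.exists_double_semi (h : P.Isomorphic Q)
    (hP : ∃ v y, P.nbrs Set.univ v = {v, v, y}) : ∃ v y, Q.nbrs Set.univ v = {v, v, y} := by
  obtain ⟨α, hα⟩ := h.exists_equiv
  obtain ⟨v, y, hv⟩ := hP
  exact ⟨α v, α y, by rw [hα, hv]; simp⟩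

/-- This invariant separates open-closed from double-open ladders. -/
theorem Isomorphic.exists_double_edge (h : P.Isomorphic Q)
    (hP : ∃ v w y, w ≠ v ∧ P.nbrs Set.univ v = {w, w, y}) :
    ∃ v w y, w ≠ v ∧ Q.nbrs Set.univ v = {w, w, y} := by
  obtain ⟨α, hα⟩ := h.exists_equiv
  obtain ⟨v, w, y, hw, hv⟩ := hP
  exact ⟨α v, α w, α y, by simpa using hw, by rw [hα, hv]; simp⟩

theorem barbedPath_exists_double_semi {n : ℕ} (hn : 0 < n) :
    ∃ v y, (barbedPath n).nbrs Set.univ v = {v, v, y} := by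
  refine ⟨⟨0, hn⟩, (barbedPath n).target (⟨0, hn⟩, 2), ?_⟩
  rw [barbedPath_nbrs, barbedPath_target_zero, barbedPath_target_one, if_neg (by simp)]

/-- The hypothesis excludes the double-open ladder with one rung, which is the barbed path on two
vertices. -/
theorem ladder_not_exists_double_semi {a b : Bool} {m : ℕ} (h : 2 ≤ m ∨ a = true ∨ b = true) :
    ¬ ∃ v y, (ladder a b m).nbrs Set.univ v = {v, v, y} := by
  rintro ⟨⟨i, s⟩, y, hv⟩
  rw [ladder_nbrs, ladder_target_zero, ladder_target_one, ladder_target_two] at hv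
  have hne : ((i, !s) : Fin m × Bool) ≠ (i, s) := by simp
  have h1 : (if 0 < i.1 then (⟨i.1 - 1, by omega⟩, s) else (i, a ^^ s) : Fin m × Bool) = (i, s) := by
    rcases triple_eq_cases hv with h | h | h | h | h | h <;> grind
  have h2 : (if h : i.1 + 1 < m then (⟨i.1 + 1, h⟩, s) else (i, b ^^ s) : Fin m × Bool) = (i, s) := by
    rcases triple_eq_cases hv with h | h | h | h | h | h <;> grind
  split_ifs at h1 h2
  all_goals simp only [Prod.mk.injEq, Fin.ext_iff] at h1 h2
  all_goals cases a <;> cases b <;> cases s <;> grind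

theorem ladder_exists_mem {b : Bool} {m : ℕ} (hm : 0 < m) :
    ∃ v, v ∈ (ladder false b m).nbrs Set.univ v := by
  refine ⟨(⟨0, hm⟩, false), ?_⟩
  rw [ladder_nbrs, ladder_target_one, if_neg (by simp)]
  simp

theorem doubleClosedLadder_not_exists_mem {m : ℕ} :
    ¬ ∃ v, v ∈ (ladder true true m).nbrs Set.univ v := by
  rintro ⟨⟨i, s⟩, hv⟩
  rw [ladder_nbrs, ladder_target_zero, ladder_target_one, ladder_target_two] at hv
  simp only [Multiset.insert_eq_cons, Multiset.mem_cons, Multiset.mem_singleton] at hv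
  split_ifs at hv <;> simp [Fin.ext_iff] at hv
  all_goals omega

theorem ladder_exists_double_edge {a : Bool} {m : ℕ} (hm : 0 < m) :
    ∃ v w y, w ≠ v ∧ (ladder a true m).nbrs Set.univ v = {w, w, y} := by
  refine ⟨(⟨m - 1, by omega⟩, false), (⟨m - 1, by omega⟩, true),
    (ladder a true m).target ((⟨m - 1, by omega⟩, false), 1), by simp, ?_⟩
  rw [ladder_nbrs, ladder_target_zero, ladder_target_two, dif_neg (by simp; omega)]
  simp only [Multiset.insert_eq_cons, ← Multiset.cons_zero]
  rw [Multiset.cons_swap ((ladder a true m).target _)]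
  rfl

theorem doubleOpenLadder_not_exists_double_edge {m : ℕ} :
    ¬ ∃ v w y, w ≠ v ∧ (ladder false false m).nbrs Set.univ v = {w, w, y} := by
  rintro ⟨⟨i, s⟩, w, y, hw, hv⟩
  rw [ladder_nbrs, ladder_target_zero, ladder_target_one, ladder_target_two] at hv
  rcases triple_eq_cases hv with h | h | h | h | h | h <;> split_ifs at h <;> cases s <;> grind

/-! ### From involutions back to factors; three factors -/

theorem TwoFactor.isomorphic_of_swap {F G : P.TwoFactor} (hP : P.IsCubic) (lP : P.Loopless)
    {χ : P.Vert → P.Vert} (h : P.IsCommutingTriple (F.partner hP) (G.partner hP) χ)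
    (hα : ∃ α : P.Vert ≃ P.Vert, (∀ v, α (F.partner hP v) = G.partner hP (α v)) ∧
      (∀ v, α (G.partner hP v) = F.partner hP (α v)) ∧ ∀ v, α (χ v) = χ (α v)) :
    F.Isomorphic G := by
  obtain ⟨α, h1, h2, h3⟩ := hα
  refine TwoFactor.isomorphic_of_equiv hP lP F G α (fun v => ?_) fun v => (h1 v).symm
  rw [h.swap.nbrs_eq, h.nbrs_eq, ← h1, ← h2, ← h3]
  simp

/-- If the partner maps agree, the identity on vertices lifts to an automorphism, which may permute
parallel edges. -/
theorem TwoFactor.exists_partner_ne {F G : P.TwoFactor} (hP : P.IsCubic) (lP : P.Loopless)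
    (h : ¬ F.Isomorphic G) : ∃ v, F.partner hP v ≠ G.partner hP v := by
  by_contra! h'
  exact h (TwoFactor.isomorphic_of_equiv hP lP F G (Equiv.refl _) (by simp) fun v => (h' v).symm)

theorem classification_of_not_isomorphic [Finite P.Vert] (hc : P.IsConnected) (hP : P.IsCubic)
    {F G : P.TwoFactor} (hF : F.IsC4QuotientFactor) (hG : G.IsC4QuotientFactor)
    (h : ¬ F.Isomorphic G) : (∃ m, Even m ∧ P.Isomorphic (barbedPath m)) ∨
      ∃ m a b, (Even m ∨ a ≠ b) ∧ P.Isomorphic (ladder a b m) := by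
  have lP := hF.loopless hP
  obtain ⟨v, hv⟩ := TwoFactor.exists_partner_ne hP lP h
  obtain ⟨-, χ, ht⟩ :=
    TwoFactor.exists_isCommutingTriple hP hc hF.isSquareAt hG.isSquareAt hv
  rcases ht.classification hc hP.locallyFinite lP with hα | h'
  · exact absurd (TwoFactor.isomorphic_of_swap hP lP ht hα) h
  · exact h'

/-- A reflection would make the step across its axis end at its starting vertex or at the χ-image of
that vertex, which the hypotheses exclude. Hence all coincidences are at even distance. -/
theorem IsCommutingTriple.exists_swap_of_ne {φ ψ χ : P.Vert → P.Vert}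
    (h : P.IsCommutingTriple φ ψ χ) (hc : P.IsConnected) (hf : P.LocallyFinite)
    (h1 : ∀ v, φ v ≠ v) (h2 : ∀ v, ψ v ≠ v) (h3 : ∀ v, φ v ≠ χ v) (h4 : ∀ v, ψ v ≠ χ v) :
    ∃ α : P.Vert ≃ P.Vert, (∀ v, α (φ v) = ψ (α v)) ∧ (∀ v, α (ψ v) = φ (α v)) ∧
      ∀ v, α (χ v) = χ (α v) := by
  obtain ⟨v₀⟩ := hc.1
  obtain ⟨p, -, hp⟩ := exists_isAlternatingWalk h.invol₁ h.invol₂ v₀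
  refine h.exists_swap_of_even hc hf hp fun i j s e => ?_
  by_contra hij
  rw [Int.not_even_iff_odd] at hij
  have t := h.walk_reflect hp hij e ((i + j - 1) / 2)
  rw [show i + j - (i + j - 1) / 2 = (i + j - 1) / 2 + 1 by grind] at t
  rcases Int.even_or_odd ((i + j - 1) / 2) with hk | hk
  · rw [← hp.even _ hk] at t
    cases s
    · exact h1 _ t
    · exact h3 _ t
  · rw [← hp.odd _ hk] at t
    cases s
    · exact h2 _ t
    · exact h4 _ t

theorem isomorphic_of_three_factors (hc : P.IsConnected) (hP : P.IsCubic) {F G H : P.TwoFactor}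
    (hF : F.IsC4QuotientFactor) (hG : G.IsC4QuotientFactor) (hH : H.IsC4QuotientFactor) :
    F.Isomorphic G ∨ F.Isomorphic H ∨ G.Isomorphic H := by
  by_contra! hcon
  obtain ⟨hFG, hFH, hGH⟩ := hcon
  have lP := hF.loopless hP
  have hf := hP.locallyFinite
  obtain ⟨_, h1⟩ := TwoFactor.exists_partner_ne hP lP hFG
  obtain ⟨_, h2⟩ := TwoFactor.exists_partner_ne hP lP hFH
  obtain ⟨_, h3⟩ := TwoFactor.exists_partner_ne hP lP hGH
  obtain ⟨nFG, χ, tFG⟩ :=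
    TwoFactor.exists_isCommutingTriple hP hc hF.isSquareAt hG.isSquareAt h1
  obtain ⟨nFH, ψ, tFH⟩ :=
    TwoFactor.exists_isCommutingTriple hP hc hF.isSquareAt hH.isSquareAt h2
  obtain ⟨nGH, φ, tGH⟩ :=
    TwoFactor.exists_isCommutingTriple hP hc hG.isSquareAt hH.isSquareAt h3
  -- The partner in `H` is one of the three neighbours and differs from the other two partners, so
  -- it is the third.
  have e1 : χ = H.partner hP := funext fun v => by
    have : H.partner hP v ∈ P.nbrs Set.univ v := by
      rw [H.nbrs_univ hP]
      exact Multiset.mem_cons_self _ _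
    rw [tFG.nbrs_eq] at this
    simp only [Multiset.insert_eq_cons, Multiset.mem_cons, Multiset.mem_singleton] at this
    rcases this with h | h | h
    · exact absurd h.symm (nFH v)
    · exact absurd h.symm (nGH v)
    · exact h.symm
  have e2 : ψ = G.partner hP := funext fun v => by
    have h := (tFG.nbrs_eq v).symm.trans (tFH.nbrs_eq v)
    rw [e1, Multiset.pair_comm] at h
    simpa [eq_comm] using h
  have e3 : φ = F.partner hP := funext fun v => by
    have h := (tFG.swap.nbrs_eq v).symm.trans (tGH.nbrs_eq v)
    rw [e1, Multiset.pair_comm] at h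
    simpa [eq_comm] using h
  subst e1 e2 e3
  -- If one partner map is the identity, the other two have no fixed points and are exchanged. If
  -- neither that of `F` nor that of `G` is, these two are exchanged.
  rcases tGH.fixed_or_free hc hf with xF | fF
  · exact hGH (TwoFactor.isomorphic_of_swap hP lP tGH (tGH.exists_swap_of_ne hc hf
      (fun v e => nFG v ((xF v).trans e.symm)) (fun v e => nFH v ((xF v).trans e.symm))
      (fun v => (nFG v).symm) fun v => (nFH v).symm))
  rcases tFH.fixed_or_free hc hf with xG | fG
  · exact hFH (TwoFactor.isomorphic_of_swap hP lP tFH (tFH.exists_swap_of_ne hc hf fF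
      (fun v e => nGH v ((xG v).trans e.symm)) nFG fun v => (nGH v).symm))
  · exact hFG (TwoFactor.isomorphic_of_swap hP lP tFG (tFG.exists_swap_of_ne hc hf fF fG nFH nGH))

/-! ### Counting the isomorphism classes -/

theorem HasMultipleC4QuotientFactors.isC4QuotientMarkable (h : P.HasMultipleC4QuotientFactors)
    (hc : P.IsConnected) (hP : P.IsCubic) : P.IsC4QuotientMarkable := by
  obtain ⟨F, _, hF, _⟩ := h
  exact ⟨hc, hP, F, hF⟩

theorem barbedPath_mem {n : ℕ} (hn : 0 < n) (hev : Even n) :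
    (⟦barbedPath n⟧ : Quotient isoSetoid) ∈ multipleFactorClasses n :=
  have h := barbedPath_hasMultiple hn hev
  ⟨_, by simp, h.isC4QuotientMarkable (barbedPath_isConnected hn) barbedPath_isCubic, h, rfl⟩

theorem ladder_mem {n m : ℕ} {a b : Bool} (hm : 0 < m) (hn : n = 2 * m)
    (h : (ladder a b m).HasMultipleC4QuotientFactors) :
    (⟦ladder a b m⟧ : Quotient isoSetoid) ∈ multipleFactorClasses n :=
  ⟨_, by simp [hn, mul_comm], h.isC4QuotientMarkable (ladder_isConnected hm) ladder_isCubic, h, rfl⟩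

theorem of_mem_multipleFactorClasses {n : ℕ} (hn : 0 < n) {c : Quotient isoSetoid}
    (hc : c ∈ multipleFactorClasses n) : (Even n ∧ c = ⟦barbedPath n⟧) ∨
      ∃ m a b, n = 2 * m ∧ (Even m ∨ a ≠ b) ∧ c = ⟦ladder a b m⟧ := by
  obtain ⟨P, hcard, ⟨hconn, hcub, -⟩, ⟨F, G, hF, hG, hFG⟩, rfl⟩ := hc
  have : Finite P.Vert := Nat.finite_of_card_ne_zero (by omega)
  rcases classification_of_not_isomorphic hconn hcub hF hG hFG with ⟨m, hm, h⟩ | ⟨m, a, b, hm, h⟩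
  · obtain ⟨f⟩ := id h
    have : n = m := by rw [← hcard, Nat.card_congr f.vert]; simp
    subst this
    exact Or.inl ⟨hm, Quotient.sound h⟩
  · obtain ⟨f⟩ := id h
    have : n = 2 * m := by rw [← hcard, Nat.card_congr f.vert]; simp [mul_comm]
    exact Or.inr ⟨m, a, b, this, hm, Quotient.sound h⟩

theorem not_mk_barbedPath_eq_mk_ladder {n m : ℕ} {a b : Bool} (hn : 0 < n)
    (h : 2 ≤ m ∨ a = true ∨ b = true) :
    (⟦barbedPath n⟧ : Quotient isoSetoid) ≠ ⟦ladder a b m⟧ := fun e =>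
  ladder_not_exists_double_semi h
    ((Quotient.exact e : Isomorphic _ _).exists_double_semi (barbedPath_exists_double_semi hn))

theorem mk_ladder_true_false (m : ℕ) :
    (⟦ladder true false m⟧ : Quotient isoSetoid) = ⟦ladder false true m⟧ :=
  Quotient.sound (ladder_flip true false m)

theorem multipleFactorClasses_of_odd {n : ℕ} (hn : n % 2 = 1) : multipleFactorClasses n = ∅ := by
  refine Set.eq_empty_of_forall_notMem fun c hc => ?_
  rcases of_mem_multipleFactorClasses (by omega) hc with ⟨h, -⟩ | ⟨m, -, -, h, -⟩
  · grind
  · omega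

theorem multipleFactorClasses_of_mod_four_eq_zero {n : ℕ} (hn : 0 < n) (h4 : n % 4 = 0) :
    multipleFactorClasses n = {⟦barbedPath n⟧, ⟦doubleClosedLadder (n / 2)⟧,
      ⟦doubleOpenLadder (n / 2)⟧, ⟦openClosedLadder (n / 2)⟧} := by
  have hev : Even (n / 2) := by grind
  ext c
  simp only [Set.mem_insert_iff, Set.mem_singleton_iff]
  constructor
  · intro hc
    rcases of_mem_multipleFactorClasses hn hc with ⟨-, rfl⟩ | ⟨m, a, b, h, -, rfl⟩
    · exact Or.inl rfl
    · have : n / 2 = m := by omega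
      rw [this]
      cases a <;> cases b
      · simp
      · simp
      · simp [mk_ladder_true_false]
      · simp
  · rintro (rfl | rfl | rfl | rfl)
    · exact barbedPath_mem hn (by grind)
    · exact ladder_mem (by omega) (by omega) (doubleClosedLadder_hasMultiple (by omega) hev)
    · exact ladder_mem (by omega) (by omega) (ladder_hasMultiple_of_open (by omega) (Or.inl hev))
    · exact ladder_mem (by omega) (by omega) (ladder_hasMultiple_of_open (by omega) (Or.inl hev))

theorem multipleFactorClasses_of_mod_four_eq_two {n : ℕ} (h4 : n % 4 = 2) :
    multipleFactorClasses n = {⟦barbedPath n⟧, ⟦openClosedLadder (n / 2)⟧} := by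
  have hodd : ¬ Even (n / 2) := by grind
  ext c
  simp only [Set.mem_insert_iff, Set.mem_singleton_iff]
  constructor
  · intro hc
    rcases of_mem_multipleFactorClasses (by omega) hc with ⟨-, rfl⟩ | ⟨m, a, b, h, hab, rfl⟩
    · exact Or.inl rfl
    · have : n / 2 = m := by omega
      rw [this] at hodd ⊢
      cases a <;> cases b
      · simp [hodd] at hab
      · simp
      · simp [mk_ladder_true_false]
      · simp [hodd] at hab
  · rintro (rfl | rfl)
    · exact barbedPath_mem (by omega) (by grind)
    · exact ladder_mem (by omega) (by omega) (ladder_hasMultiple_of_open (by omega) (Or.inr rfl))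

theorem encard_barbedPath_ladders {n m : ℕ} (hn : 0 < n) (hm : 2 ≤ m) :
    ({⟦barbedPath n⟧, ⟦doubleClosedLadder m⟧, ⟦doubleOpenLadder m⟧, ⟦openClosedLadder m⟧} :
      Set (Quotient isoSetoid)).encard = 4 := by
  have h1 : ∀ b, (⟦ladder true true m⟧ : Quotient isoSetoid) ≠ ⟦ladder false b m⟧ := fun b e =>
    doubleClosedLadder_not_exists_mem
      ((Quotient.exact e.symm : Isomorphic _ _).exists_mem (ladder_exists_mem (by omega)))
  have h2 : (⟦ladder false false m⟧ : Quotient isoSetoid) ≠ ⟦ladder false true m⟧ := fun e =>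
    doubleOpenLadder_not_exists_double_edge
      ((Quotient.exact e.symm : Isomorphic _ _).exists_double_edge
        (ladder_exists_double_edge (by omega)))
  have h3 : ∀ a b, (⟦barbedPath n⟧ : Quotient isoSetoid) ≠ ⟦ladder a b m⟧ := fun a b =>
    not_mk_barbedPath_eq_mk_ladder hn (Or.inl hm)
  rw [Set.encard_insert_of_notMem, Set.encard_insert_of_notMem, Set.encard_pair h2]
  · rfl
  · simpa only [Set.mem_insert_iff, Set.mem_singleton_iff, not_or] using ⟨h1 _, h1 _⟩
  · simpa only [Set.mem_insert_iff, Set.mem_singleton_iff, not_or] using ⟨h3 _ _, h3 _ _, h3 _ _⟩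

end Pregraph

theorem mainTheorem1 :
    (∀ n : ℕ, 0 < n →
      (n % 2 = 1 → (Pregraph.multipleFactorClasses n).encard = 0) ∧
      (n % 4 = 0 → (Pregraph.multipleFactorClasses n).encard = 4 ∧
        Pregraph.multipleFactorClasses n =
          {⟦Pregraph.barbedPath n⟧, ⟦Pregraph.doubleClosedLadder (n / 2)⟧,
            ⟦Pregraph.doubleOpenLadder (n / 2)⟧, ⟦Pregraph.openClosedLadder (n / 2)⟧}) ∧
      (n % 4 = 2 → (Pregraph.multipleFactorClasses n).encard = 2 ∧
        Pregraph.multipleFactorClasses n =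
          {⟦Pregraph.barbedPath n⟧, ⟦Pregraph.openClosedLadder (n / 2)⟧})) ∧
    (∀ P : Pregraph, Finite P.Vert → P.IsC4QuotientMarkable →
      ∀ F G H : P.TwoFactor,
        F.IsC4QuotientFactor → G.IsC4QuotientFactor → H.IsC4QuotientFactor →
          F.Isomorphic G ∨ F.Isomorphic H ∨ G.Isomorphic H) := by
  refine ⟨fun n hn => ⟨fun h => ?_, fun h => ?_, fun h => ?_⟩, ?_⟩
  · rw [Pregraph.multipleFactorClasses_of_odd h, Set.encard_empty]
  · rw [Pregraph.multipleFactorClasses_of_mod_four_eq_zero hn h]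
    exact ⟨Pregraph.encard_barbedPath_ladders hn (by omega), rfl⟩
  · rw [Pregraph.multipleFactorClasses_of_mod_four_eq_two h]
    exact ⟨Set.encard_pair (Pregraph.not_mk_barbedPath_eq_mk_ladder hn (Or.inr (Or.inr rfl))), rfl⟩
  · rintro P - ⟨hc, hP, -⟩ F G H hF hG hH
    exact Pregraph.isomorphic_of_three_factors hc hP hF hG hH
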